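/- **Setting.** Let $H:\mathbb R^2\to\mathbb R$ be four times continuously differentiable with bounded second derivatives, with finitely many critical points, all non-degenerate and with pairwise distinct critical values, with $\min H=0$, and such that for some $a>0$ and all $|x|$ large enough $H(x)\ge a|x|^2$, $|\nabla H(x)|\ge a|x|$, $\Delta H(x)\ge a$. Let $\nabla^\perp H=(\partial_2H,-\partial_1H)$, let $B$ be a standard planar Brownian motion, and for $\epsilon>0$, $x\in\mathbb R^2$ let $X^x_\epsilon$ solve $$dX(t)=\tfrac1\epsilon\nabla^\perp H(X(t))\,dt+dB(t),\qquad X(0)=x.$$ Let $S_\epsilon(t)u(x)=\mathbf E\,u(X^x_\epsilon(t))$ be its Markov semigroup, and $G_\epsilon(t,x,y)$ its transition density for $t>0$. Let $\Gamma$ be the graph obtained from $\mathbb R^2$ by identifying the points of each connected component of each level set of $H$, and $\Pi:\mathbb R^2\to\Gamma$ the projection. Let $\gamma:\Gamma\to(0,\infty)$ be continuous, with $\gamma^\vee:=\gamma\circ\Pi\in L^1(\mathbb R^2)$, and assume that $\gamma$ is an admissible weight: there is $C\ge0$ with $$\int_{\mathbb R^2}G_\epsilon(t,x,y)\,\gamma^\vee(x)\,dx\le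 e^{Ct}\gamma^\vee(y)\qquad\text{for all }\epsilon>0,\ t>0,\ y\in\mathbb R^2.$$ Set $H_\gamma=L^2(\mathbb R^2,\gamma^\vee(x)\,dx)$. Let $\mu$ be a symmetric tempered measure on $\mathbb R^2$ (the spectral measure of a spatially homogeneous Wiener process) with a density $m\ge0$, $m\in L^p(\mathbb R^2)$, where $p\in(1,\infty)$. For real Schwartz functions put $Q(\varphi,\psi)=\int\widehat\varphi\,\overline{\widehat\psi}\,d\mu$ and $q(\varphi)=Q(\varphi,\varphi)^{1/2}$. Let $\mathscr S_q$ be the Hilbert space obtained by completing $\mathscr S/\ker Q$ in the norm $q$, and let $\mathscr S_q'$ be its dual, identified with the space of the tempered distributions $\xi$ with $|\langle\xi,\varphi\rangle|\le C q(\varphi)$ for some $C$ and all $\varphi\in\mathscr S$. For $\psi\in H_\gamma$, $M(\psi)\xi=\psi\xi$. **Statement.** Every $\xi\in\mathscr S_q'$ is a function, and for all $\epsilon>0$, $t>0$ and $\psi\in H_\gamma$ the operator $S_\epsilon(t)M(\psi):\xi\mapsto S_\epsilon(t)(\psi\xi)$ is well defined (the expectation $\mathbf E\,(\psi\xi)(X^x_\epsilon(t))$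 converges absolutely for almost every $x$) and is a Hilbert–Schmidt operator from $\mathscr S_q'$ to $H_\gamma$. Moreover, for each $T>0$ there is a constant $C_T>0$, independent of $\epsilon$, $m$, $\psi$ and $t$ (it may depend on $T$, $p$, $H$, $\gamma$), such that $$\|S_\epsilon(t)M(\psi)\|^2_{L_{(HS)}(\mathscr S_q',H_\gamma)}\le C_T\,\|m\|_{L^p}\,t^{-(p-1)/p}\,|\psi|^2_{H_\gamma},\qquad t\in(0,T],\ \epsilon>0.$$ -/

import Mathlib

open MeasureTheory ProbabilityTheory Set Filter Topology
open scoped NNReal ENNReal SchwartzMap FourierTransform ComplexConjugate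

/-- The Euclidean plane. -/
abbrev Plane : Type := EuclideanSpace ℝ (Fin 2)

/-! ### The Hamiltonian and its graph -/

/-- The skew gradient `(∂₂ H, -∂₁ H)`. -/
noncomputable def skewGradient (H : Plane → ℝ) (x : Plane) : Plane :=
  !₂[gradient H x 1, -(gradient H x 0)]

/-- The standing assumptions on the Hamiltonian. -/
structure IsGenericHamiltonian (H : Plane → ℝ) : Prop where
  contDiff : ContDiff ℝ 4 H
  bounded_second : ∃ K : ℝ, ∀ x, ‖iteratedFDeriv ℝ 2 H x‖ ≤ K
  finite_critical : {x : Plane | gradient H x = 0}.Finite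
  nondegenerate : ∀ x, gradient H x = 0 →
    ∀ v : Plane, (∀ w : Plane, iteratedFDeriv ℝ 2 H x ![v, w] = 0) → v = 0
  critical_values : InjOn H {x : Plane | gradient H x = 0}
  growth : ∃ a : ℝ, 0 < a ∧ ∃ R : ℝ, ∀ x : Plane, R ≤ ‖x‖ →
    a * ‖x‖ ^ 2 ≤ H x ∧ a * ‖x‖ ≤ ‖gradient H x‖ ∧ a ≤ Laplacian.laplacian H x
  min_eq_zero : IsLeast (range H) 0

/-- Two points are identified when they lie on the same connected component of the same level set
of `H`; such a component determines its level. -/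
def levelSetoid (H : Plane → ℝ) : Setoid Plane :=
  Setoid.ker fun x : Plane => connectedComponentIn (H ⁻¹' {H x}) x

/-- The graph `Γ` of the Hamiltonian `H`, with the quotient topology. -/
abbrev LevelGraph (H : Plane → ℝ) : Type := Quotient (levelSetoid H)

/-- The identification map `Π : ℝ² → Γ`. -/
def graphProj (H : Plane → ℝ) (x : Plane) : LevelGraph H := Quotient.mk (levelSetoid H) x

/-- The lift `f^∨ = f ∘ Π` to the plane of a function `f` on the graph. -/
def liftToPlane {H : Plane → ℝ} (f : LevelGraph H → ℝ) (x : Plane) : ℝ := f (graphProj H x)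

/-! ### The fast diffusion and its Markov semigroup -/

section Diffusion

variable {Ω : Type*} [MeasurableSpace Ω]

/-- A standard planar Brownian motion started at `0`: the coordinates are independent standard
real Brownian motions. -/
structure IsPlanarBrownianMotion (B : ℝ≥0 → Ω → Plane) (P : Measure Ω) : Prop where
  coord : ∀ i : Fin 2, IsBrownianReal (fun t ω => B t ω i) P
  indep : IndepFun (fun ω (t : ℝ≥0) => B t ω 0) (fun ω (t : ℝ≥0) => B t ω 1) P

/-- `X` is a continuous solution of `dX = ε⁻¹ ∇^⊥ H(X) dt + dB`, `X(0) = x`. As the noise is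
additive, the equation is an integral equation along almost every path. -/
structure IsFastDiffusion (P : Measure Ω) (B : ℝ≥0 → Ω → Plane) (H : Plane → ℝ) (ε : ℝ)
    (x : Plane) (X : ℝ≥0 → Ω → Plane) : Prop where
  aemeasurable : ∀ t, AEMeasurable (X t) P
  continuous : ∀ᵐ ω ∂P, Continuous fun t => X t ω
  equation : ∀ᵐ ω ∂P, ∀ t : ℝ≥0,
    X t ω = x + (∫ s in (0 : ℝ)..t, ε⁻¹ • skewGradient H (X s.toNNReal ω)) + B t ω

/-- The Markov semigroup `S(t) u (x) = 𝐄 u(X^x(t))` of a family `X x` of processes, indexed by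
their starting points `x`. -/
noncomputable def markovSemigroup (P : Measure Ω) (X : Plane → ℝ≥0 → Ω → Plane) (t : ℝ≥0)
    (u : Plane → ℝ) (x : Plane) : ℝ :=
  ∫ ω, u (X x t ω) ∂P

/-- The finite measure `γ^∨(x) dx` on the plane. -/
noncomputable def weightMeasure {H : Plane → ℝ} (γ : LevelGraph H → ℝ) : Measure Plane :=
  volume.withDensity fun x => ENNReal.ofReal (liftToPlane γ x)

/-- The weighted space `H_γ = L²(ℝ², γ^∨(x) dx)`. -/
abbrev WeightedSpace {H : Plane → ℝ} (γ : LevelGraph H → ℝ) : Type :=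
  Lp ℝ 2 (weightMeasure γ)

/-- `γ` is a positive continuous function on the graph with `γ^∨` integrable that is admissible for
all the semigroups `S_ε(t)` of the processes `X ε x`, with one constant `C` for all `ε`:
`∫ G_ε(t, x, y) γ^∨(x) dx ≤ e^{C t} γ^∨(y)`. The inequality for the transition densities `G_ε` is
written for the transition probabilities `ℙ(X_ε^x(t) ∈ A) = ∫_A G_ε(t, x, y) dy`. -/
structure IsAdmissibleWeight (P : Measure Ω) (X : ℝ → Plane → ℝ≥0 → Ω → Plane)
    {H : Plane → ℝ} (γ : LevelGraph H → ℝ) : Prop where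
  continuous : Continuous γ
  pos : ∀ y, 0 < γ y
  integrable : Integrable (liftToPlane γ) volume
  admissible : ∃ C : ℝ, 0 ≤ C ∧ ∀ ε : ℝ, 0 < ε → ∀ t : ℝ≥0, 0 < t →
    ∀ A : Set Plane, MeasurableSet A →
      ∫⁻ x, P.map (X ε x t) A ∂(weightMeasure γ)
        ≤ ENNReal.ofReal (Real.exp (C * t)) * weightMeasure γ A

end Diffusion

/-! ### The reproducing kernel space of a spatially homogeneous Wiener process -/

/-- The Fourier transform of a real Schwartz function. -/
noncomputable def realFourier (φ : 𝓢(Plane, ℝ)) : 𝓢(Plane, ℂ) :=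
  𝓕 (SchwartzMap.postcompCLM Complex.ofRealCLM φ)

/-- The covariance form with spectral measure `μ`: `Q(φ, ψ) = ⟨μ^, φ ∗ ψ(-·)⟩ = ∫ φ^ conj(ψ^) dμ`.
For symmetric `μ` the imaginary part of the integral vanishes. -/
noncomputable def spectralForm (μ : Measure Plane) (φ ψ : 𝓢(Plane, ℝ)) : ℝ :=
  ∫ ξ, (realFourier φ ξ * conj (realFourier ψ ξ)).re ∂μ

theorem realFourier_add (φ ψ : 𝓢(Plane, ℝ)) :
    realFourier (φ + ψ) = realFourier φ + realFourier ψ := by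
  simp [realFourier, map_add, FourierTransform.fourier_add]

theorem realFourier_smul (r : ℝ) (φ : 𝓢(Plane, ℝ)) :
    realFourier (r • φ) = (r : ℂ) • realFourier φ := by
  have h : SchwartzMap.postcompCLM Complex.ofRealCLM (r • φ)
      = (r : ℂ) • SchwartzMap.postcompCLM Complex.ofRealCLM φ := by
    ext x
    simp
  rw [realFourier, h, FourierTransform.fourier_smul, realFourier]

theorem integrable_spectralForm (μ : Measure Plane) [μ.HasTemperateGrowth]
    (φ ψ : 𝓢(Plane, ℝ)) :
    Integrable (fun ξ => (realFourier φ ξ * conj (realFourier ψ ξ)).re) μ := by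
  have h1 := (realFourier φ).memLp 2 μ
  have h2 := ((realFourier ψ).memLp 2 μ).star
  exact (h1.integrable_mul h2).re

theorem spectralForm_add_left (μ : Measure Plane) [μ.HasTemperateGrowth]
    (φ ψ χ : 𝓢(Plane, ℝ)) :
    spectralForm μ (φ + ψ) χ = spectralForm μ φ χ + spectralForm μ ψ χ := by
  unfold spectralForm
  rw [← integral_add (integrable_spectralForm μ φ χ) (integrable_spectralForm μ ψ χ)]
  refine integral_congr_ae (Eventually.of_forall fun ξ => ?_)
  simp [realFourier_add, add_mul]

theorem spectralForm_smul_left (μ : Measure Plane) (r : ℝ) (φ ψ : 𝓢(Plane, ℝ)) :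
    spectralForm μ (r • φ) ψ = r * spectralForm μ φ ψ := by
  unfold spectralForm
  rw [← integral_const_mul]
  refine integral_congr_ae (Eventually.of_forall fun ξ => ?_)
  simp only [realFourier_smul, smul_apply, smul_eq_mul, mul_assoc, Complex.re_ofReal_mul]

/-- The space of real Schwartz functions, to be normed by `q(φ) = Q(φ, φ)^{1/2}`. -/
def QSchwartz (_μ : Measure Plane) : Type := 𝓢(Plane, ℝ)

noncomputable instance (μ : Measure Plane) : AddCommGroup (QSchwartz μ) :=
  inferInstanceAs (AddCommGroup 𝓢(Plane, ℝ))

noncomputable instance (μ : Measure Plane) : Module ℝ (QSchwartz μ) :=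
  inferInstanceAs (Module ℝ 𝓢(Plane, ℝ))

/-- The covariance form as a positive semidefinite inner product on Schwartz functions. -/
@[reducible] noncomputable def spectralCore (μ : Measure Plane) [μ.HasTemperateGrowth] :
    PreInnerProductSpace.Core ℝ (QSchwartz μ) where
  inner φ ψ := spectralForm μ φ ψ
  conj_inner_symm φ ψ := by
    refine integral_congr_ae (Eventually.of_forall fun ξ => ?_)
    simp only [Complex.mul_re, Complex.conj_re, Complex.conj_im]
    ring
  re_inner_nonneg φ := by
    refine integral_nonneg fun ξ => ?_
    simp only [Complex.mul_re, Complex.conj_re, Complex.conj_im, Pi.zero_apply]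
    nlinarith [sq_nonneg (realFourier φ ξ).re, sq_nonneg (realFourier φ ξ).im]
  add_left φ ψ χ := spectralForm_add_left μ φ ψ χ
  smul_left φ ψ r := spectralForm_smul_left μ r φ ψ

noncomputable instance (μ : Measure Plane) [μ.HasTemperateGrowth] :
    SeminormedAddCommGroup (QSchwartz μ) :=
  @InnerProductSpace.Core.toSeminormedAddCommGroup ℝ (QSchwartz μ) _ _ _ (spectralCore μ)

noncomputable instance (μ : Measure Plane) [μ.HasTemperateGrowth] :
    InnerProductSpace ℝ (QSchwartz μ) :=
  InnerProductSpace.ofCore (spectralCore μ)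

/-- The Hilbert space `𝒮_q`: the (Hausdorff) completion of Schwartz space under `q`, that is, the
completion of the quotient by `Ker Q`. -/
abbrev QCompletion (μ : Measure Plane) [μ.HasTemperateGrowth] : Type :=
  UniformSpace.Completion (QSchwartz μ)

/-- The class `[φ]` in `𝒮_q` of a Schwartz function `φ`. -/
noncomputable def qClass (μ : Measure Plane) [μ.HasTemperateGrowth] (φ : 𝓢(Plane, ℝ)) :
    QCompletion μ :=
  ((show QSchwartz μ from φ : QSchwartz μ) : UniformSpace.Completion (QSchwartz μ))

/-- The reproducing kernel space `𝒮_q'`: the dual of `𝒮_q`. Its element `ξ` is the tempered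
distribution `φ ↦ ξ [φ]`; the distributions so obtained are those with `|⟨ξ, φ⟩| ≤ C q(φ)`. -/
abbrev QDual (μ : Measure Plane) [μ.HasTemperateGrowth] : Type :=
  StrongDual ℝ (QCompletion μ)

/-- The Hilbert space structure of `𝒮_q'`, carried over from `𝒮_q` by the Riesz isometry; its norm
is the dual norm. -/
noncomputable instance (μ : Measure Plane) [μ.HasTemperateGrowth] :
    InnerProductSpace ℝ (QDual μ) where
  inner ξ η := inner ℝ ((InnerProductSpace.toDual ℝ (QCompletion μ)).symm ξ)
    ((InnerProductSpace.toDual ℝ (QCompletion μ)).symm η)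
  norm_sq_eq_re_inner ξ := by
    rw [← (InnerProductSpace.toDual ℝ (QCompletion μ)).symm.norm_map ξ]
    exact InnerProductSpace.norm_sq_eq_re_inner _
  conj_inner_symm ξ η := InnerProductSpace.conj_inner_symm _ _
  add_left ξ η ζ := by
    have h := (InnerProductSpace.toDual ℝ (QCompletion μ)).symm.toLinearEquiv.map_add ξ η
    exact (congrArg (fun v => inner ℝ v ((InnerProductSpace.toDual ℝ (QCompletion μ)).symm ζ))
      h).trans (inner_add_left _ _ _)
  smul_left ξ η r := by
    have h := (InnerProductSpace.toDual ℝ (QCompletion μ)).symm.toLinearEquiv.map_smulₛₗ r ξ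
    exact (congrArg (fun v => inner ℝ v ((InnerProductSpace.toDual ℝ (QCompletion μ)).symm η))
      h).trans (inner_smul_left _ _ _)

/-- The distribution `ξ ∈ 𝒮_q'` is the function `f`. -/
def IsFunction {μ : Measure Plane} [μ.HasTemperateGrowth] (ξ : QDual μ) (f : Plane → ℝ) : Prop :=
  LocallyIntegrable f volume ∧
    ∀ φ : 𝓢(Plane, ℝ), Integrable (fun x => f x * φ x) volume ∧
      ξ (qClass μ φ) = ∫ x, f x * φ x

/-! ### Hilbert–Schmidt operators -/

/-- The squared Hilbert–Schmidt norm `∑ᵢ ‖A eᵢ‖²` of an operator `A` on a Hilbert space. The sum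
does not depend on the orthonormal basis, and the supremum is over all orthonormal bases. -/
noncomputable def hilbertSchmidtSq {E F : Type*} [NormedAddCommGroup E] [InnerProductSpace ℝ E]
    [NormedAddCommGroup F] [InnerProductSpace ℝ F] (A : E →L[ℝ] F) : ℝ≥0∞ :=
  ⨆ (w : Set E) (b : HilbertBasis w ℝ E), ∑' i, ‖A (b i)‖ₑ ^ 2

/-- `A` is a Hilbert–Schmidt operator. -/
def IsHilbertSchmidt {E F : Type*} [NormedAddCommGroup E] [InnerProductSpace ℝ E]
    [NormedAddCommGroup F] [InnerProductSpace ℝ F] (A : E →L[ℝ] F) : Prop :=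
  hilbertSchmidtSq A < ∞

/-- `A` is the operator `S(t) M(ψ) : 𝒮_q' → H_γ`: every `ξ ∈ 𝒮_q'` is a function `f`, and
`A ξ = S(t) (ψ f)`, where the expectation that defines `S(t) (ψ f) (x)` exists for almost
every `x`. -/
def IsSemigroupMul {Ω : Type*} [MeasurableSpace Ω] (P : Measure Ω)
    (X : Plane → ℝ≥0 → Ω → Plane) (t : ℝ≥0) {H : Plane → ℝ} {γ : LevelGraph H → ℝ}
    (ψ : WeightedSpace γ) {μ : Measure Plane} [μ.HasTemperateGrowth]
    (A : QDual μ →L[ℝ] WeightedSpace γ) : Prop :=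
  ∀ ξ : QDual μ, ∃ f : Plane → ℝ, IsFunction ξ f ∧
    ∀ᵐ x ∂(volume : Measure Plane), Integrable (fun ω => ψ (X x t ω) * f (X x t ω)) P ∧
      A ξ x = markovSemigroup P X t (fun y => ψ y * f y) x

/-! ### Fourier transforms of functions in `L¹ ∩ L²` -/

/-! For fixed `x`, let `κ` be the law of `X_ε^x(t)`. The heart of the proof is that `κ` has a
density `g ≤ M = 64/(πt)`, with no dependence on `ε` (`map_fastDiffusion_le`). Formally this is
Nash's argument: the drift is divergence free, so it changes neither mass nor `L²` norm, while the
noise increases `1/‖u‖₂²` at a rate proportional to `1/‖u‖₁²`. This gives an `L¹ → L²` bound for the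
semigroup and its dual, and their product is an `L¹ → L^∞` bound.

The argument is carried out on the Euler scheme, which composes maps `x ↦ x + r ∇^⊥H(x)` with
Gaussian translations. A Gaussian average gains a fixed amount in `1/‖u‖₂²` (`IsTame.nash_step`).
The Euler map has Jacobian `1 + O(r²)`, so the total volume distortion over all steps stays below
`2` once the number of steps is large. How large depends on `ε`, but the resulting bound does not,
and it survives the limit because the noise is additive and the scheme converges along almost every
path.

The Fourier transform embeds `𝒮_q'` isometrically in `L²(μ)`, and an element with image `F` is the
function `𝓕⁻¹(F m)` (`exists_function_of_spectralDensity`). Hence `S(t)(ψξ)(x) = ∫ f h` with `h = g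
ψ` is an inner product of `F` with `𝓕h`. By Bessel's inequality the squares of these values over an
orthonormal basis sum to at most `∫ |𝓕h|² m`. Put `D = S(t)ψ²(x)`; then `‖h‖₁² ≤ D` and `‖h‖₂² ≤ M
D`. Splitting `m` at a suitable level gives `∫ |𝓕h|² m ≤ 2 ‖m‖_p M^{(p-1)/p} D`
(`integral_norm_fourier_sq_le`). Integrating `D` against the admissible weight costs `e^{Ct} |ψ|²`,
which is the claim. -/

theorem integral_conj_fourier_mul {f g : Plane → ℂ} (hf : Integrable f) (hg : Integrable g) :
    ∫ ξ, conj (𝓕 f ξ) * g ξ = ∫ x, conj (f x) * 𝓕⁻ g x := by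
  have h := VectorFourier.integral_sesq_fourierIntegral_eq_neg_flip (μ := (volume : Measure Plane))
    (ν := (volume : Measure Plane)) (L := innerₗ Plane) (e := Real.fourierChar)
    (innerSL ℂ : ℂ →L⋆[ℂ] ℂ →L[ℂ] ℂ)
    Real.continuous_fourierChar (by exact continuous_inner) hf hg
  have h2 : ∀ z w : ℂ, (innerSL ℂ z) w = conj z * w := fun z w => by simp [mul_comm]
  simp only [h2] at h
  convert! h using 4 with x
  simp only [Real.fourierInv_eq, VectorFourier.fourierIntegral]
  congr with y
  simp [real_inner_comm]

/-- Both transforms have the same pairing with every test function `G`, namely `∫ conj h · 𝓕⁻G`: one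
by the multiplication formula, the other by Plancherel. -/
theorem fourier_toLp_ae_eq {h : Plane → ℂ} (h1 : Integrable h) (h2 : MemLp h 2) :
    (𝓕 (h2.toLp h) : Lp ℂ 2 (volume : Measure Plane)) =ᵐ[volume] 𝓕 h := by
  have hc : Continuous (𝓕 h) :=
    VectorFourier.fourierIntegral_continuous Real.continuous_fourierChar
      (by exact continuous_inner) h1
  refine ae_eq_of_integral_contDiff_smul_eq
    ((Lp.memLp _).locallyIntegrable (by norm_num)) hc.locallyIntegrable fun g hg hgs => ?_
  set G : 𝓢(Plane, ℂ) := HasCompactSupport.toSchwartzMap (f := fun x => (g x : ℂ))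
    (hgs.comp_left (g := fun y : ℝ => (y : ℂ)) (by simp)) (Complex.ofRealCLM.contDiff.comp hg)
    with hG
  have hGg : ∀ x, G x = (g x : ℂ) := fun x => rfl
  have e1 : ∫ ξ, conj (𝓕 h ξ) * G ξ = ∫ x, conj (h x) * (𝓕⁻ G) x := by
    rw [integral_conj_fourier_mul h1 G.integrable]
    simp [SchwartzMap.fourierInv_coe]
  have e2 : ∫ ξ, conj ((𝓕 (h2.toLp h) : Lp ℂ 2 (volume : Measure Plane)) ξ) * G ξ
      = ∫ x, conj (h x) * (𝓕⁻ G) x := by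
    have a1 := Lp.inner_fourier_eq (h2.toLp h) (𝓕⁻ (G.toLp 2))
    rw [FourierTransform.fourier_fourierInv_eq, SchwartzMap.toLp_fourierInv_eq, L2.inner_def,
      L2.inner_def] at a1
    refine (integral_congr_ae ?_).trans (a1.trans (integral_congr_ae ?_))
    · filter_upwards [G.coeFn_toLp 2] with x hx
      rw [hx]
      simp [mul_comm]
    · filter_upwards [(𝓕⁻ G).coeFn_toLp 2, h2.coeFn_toLp] with x hx hx'
      rw [hx, hx']
      simp [mul_comm]
  have key := congrArg conj (e2.trans e1.symm)
  rw [← integral_conj, ← integral_conj] at key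
  simpa [hGg, mul_comm] using key

theorem memLp_fourier {h : Plane → ℂ} (h1 : Integrable h) (h2 : MemLp h 2) :
    MemLp (𝓕 h) 2 :=
  (Lp.memLp (𝓕 (h2.toLp h))).ae_eq (fourier_toLp_ae_eq h1 h2)

theorem toLp_fourier_eq {h : Plane → ℂ} (h1 : Integrable h) (h2 : MemLp h 2) :
    (memLp_fourier h1 h2).toLp (𝓕 h) = 𝓕 (h2.toLp h) :=
  Lp.ext ((memLp_fourier h1 h2).coeFn_toLp.trans (fourier_toLp_ae_eq h1 h2).symm)

theorem integral_norm_sq_eq_norm_toLp {α : Type*} [MeasurableSpace α] {μ : Measure α} {h : α → ℂ}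
    (h2 : MemLp h 2 μ) : ∫ x, ‖h x‖ ^ 2 ∂μ = ‖h2.toLp h‖ ^ 2 := by
  have := L2.inner_def (𝕜 := ℂ) (h2.toLp h) (h2.toLp h)
  rw [inner_self_eq_norm_sq_to_K] at this
  have e : ∫ x, ((‖h x‖ ^ 2 : ℝ) : ℂ) ∂μ = ((‖h2.toLp h‖ ^ 2 : ℝ) : ℂ) := by
    push_cast
    refine Eq.trans (integral_congr_ae ?_) this.symm
    filter_upwards [h2.coeFn_toLp] with x hx
    rw [hx, inner_self_eq_norm_sq_to_K]
    simp
  rw [integral_complex_ofReal] at e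
  exact_mod_cast e

theorem integral_norm_sq_fourier {h : Plane → ℂ} (h1 : Integrable h) (h2 : MemLp h 2) :
    ∫ ξ, ‖𝓕 h ξ‖ ^ 2 = ∫ x, ‖h x‖ ^ 2 := by
  rw [integral_norm_sq_eq_norm_toLp (memLp_fourier h1 h2), integral_norm_sq_eq_norm_toLp h2,
    toLp_fourier_eq h1 h2, Lp.norm_fourier_eq]

theorem norm_fourier_le {h : Plane → ℂ} (ξ : Plane) : ‖𝓕 h ξ‖ ≤ ∫ x, ‖h x‖ :=
  VectorFourier.norm_fourierIntegral_le_integral_norm _ _ _ _ _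

/-! ### The Nash inequality along the heat flow -/

theorem one_sub_exp_neg_ge {z : ℝ} (h0 : 0 ≤ z) (h1 : z ≤ 1) : z / 2 ≤ 1 - Real.exp (-z) := by
  have h := Real.add_one_le_exp z
  have h2 : Real.exp (-z) * Real.exp z = 1 := by rw [← Real.exp_add]; simp
  have h3 := Real.exp_pos (-z)
  nlinarith

theorem integral_gaussian_plane {s : ℝ} (hs : 0 < s) :
    Integrable (fun ξ : Plane => Real.exp (-s * ‖ξ‖ ^ 2)) ∧
      ∫ ξ : Plane, Real.exp (-s * ‖ξ‖ ^ 2) = Real.pi / s := by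
  have h := GaussianFourier.integral_rexp_neg_mul_sq_norm (V := Plane) hs
  have h' : ∫ ξ : Plane, Real.exp (-s * ‖ξ‖ ^ 2) = Real.pi / s := by
    rw [h]; simp
  refine ⟨?_, h'⟩
  by_contra hn
  rw [integral_undef hn] at h'
  have : 0 < Real.pi / s := by positivity
  linarith

/-- Division-free form of `1/v ≥ 1/V + s/(8πA)`, with `V` the mass of `g` and `v` its damped mass.
Since `g ≤ A`, at least half of the mass lies outside a disc of area `V/(2A)`, and there the
Gaussian factor is small. -/
theorem integral_exp_mul_decay {g : Plane → ℝ} (hg : Integrable g) (h0 : ∀ ξ, 0 ≤ g ξ)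
    {A : ℝ} (hA : 0 < A) (hgA : ∀ ξ, g ξ ≤ A) {s : ℝ} (hs : 0 < s) :
    (∫ ξ, Real.exp (-s * ‖ξ‖ ^ 2) * g ξ) * (8 * Real.pi * A + s * ∫ ξ, g ξ)
      ≤ 8 * Real.pi * A * ∫ ξ, g ξ := by
  obtain ⟨hG, hGi⟩ := integral_gaussian_plane hs
  have hpi := Real.pi_pos
  set V := ∫ ξ, g ξ with hV
  have hV0 : 0 ≤ V := integral_nonneg h0
  have hle : ∀ ξ : Plane, Real.exp (-s * ‖ξ‖ ^ 2) ≤ 1 := fun ξ => by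
    rw [Real.exp_le_one_iff]; nlinarith [sq_nonneg ‖ξ‖]
  have hi : Integrable (fun ξ : Plane => Real.exp (-s * ‖ξ‖ ^ 2) * g ξ) := by
    refine hg.mono (hG.aestronglyMeasurable.mul hg.aestronglyMeasurable)
      (Eventually.of_forall fun ξ => ?_)
    rw [norm_mul, Real.norm_of_nonneg (Real.exp_pos _).le]
    exact mul_le_of_le_one_left (norm_nonneg _) (hle ξ)
  set v := ∫ ξ, Real.exp (-s * ‖ξ‖ ^ 2) * g ξ with hv
  have hv0 : 0 ≤ v := integral_nonneg fun ξ => mul_nonneg (Real.exp_pos _).le (h0 ξ)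
  -- For large `s V`, bounding `g` by `A` under the Gaussian already gives `v ≤ πA/s`.
  rcases le_or_gt (2 * Real.pi * A) (s * V) with hz | hz
  · have b1 : v * s ≤ Real.pi * A := by
      have : v ≤ Real.pi / s * A := by
        rw [← hGi, ← integral_mul_const]
        exact integral_mono hi (hG.mul_const A) fun ξ =>
          mul_le_mul_of_nonneg_left (hgA ξ) (Real.exp_pos _).le
      calc v * s ≤ Real.pi / s * A * s := by gcongr
        _ = _ := by field_simp
    calc v * (8 * Real.pi * A + s * V) ≤ v * (8 * (s * V)) := by
          gcongr; nlinarith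
      _ = (v * s) * (8 * V) := by ring
      _ ≤ (Real.pi * A) * (8 * V) := by gcongr
      _ = _ := by ring
  -- The squared radius for which the disc can hold at most `A · π r2 = V/2`.
  · set r2 := V / (2 * Real.pi * A) with hr2
    have hr0 : 0 ≤ r2 := by positivity
    set R := Real.sqrt r2 with hR
    have hRR : R ^ 2 = r2 := Real.sq_sqrt hr0
    have hball : (volume : Measure Plane).real (Metric.ball 0 R) = Real.pi * r2 := by
      rw [Measure.real, EuclideanSpace.volume_ball_fin_two, ← ENNReal.ofReal_pow (Real.sqrt_nonneg _),
        hRR]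
      simp [hr0, mul_comm]
      exact Or.inl Real.pi_pos.le
    set e := 1 - Real.exp (-(s * r2)) with he
    have he0 : 0 ≤ e := by
      have : Real.exp (-(s * r2)) ≤ 1 := by rw [Real.exp_le_one_iff]; nlinarith
      linarith
    have hind : Integrable ((Metric.ball (0 : Plane) R).indicator fun _ => A) :=
      (integrable_indicator_iff measurableSet_ball).2 (integrableOn_const (by
        exact measure_ball_lt_top.ne))
    -- Pointwise comparison: inside the disc `g - A ≤ 0`, outside it `e` is at most the fraction
    -- lost to damping.
    have key : e * (V - Real.pi * r2 * A) ≤ V - v := by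
      have e1 : V - v = ∫ ξ, (g ξ - Real.exp (-s * ‖ξ‖ ^ 2) * g ξ) := (integral_sub hg hi).symm
      have e2 : e * (V - Real.pi * r2 * A)
          = ∫ ξ, e * (g ξ - (Metric.ball (0 : Plane) R).indicator (fun _ => A) ξ) := by
        rw [integral_const_mul, integral_sub hg hind, integral_indicator measurableSet_ball,
          setIntegral_const, hball, smul_eq_mul]
      rw [e1, e2]
      refine integral_mono ((hg.sub hind).const_mul _) (hg.sub hi) fun ξ => ?_
      dsimp only
      by_cases hξ : ξ ∈ Metric.ball (0 : Plane) R
      · rw [indicator_of_mem hξ]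
        have := mul_nonneg (sub_nonneg.2 (hle ξ)) (h0 ξ)
        have := mul_nonneg he0 (sub_nonneg.2 (hgA ξ))
        nlinarith
      · rw [indicator_of_notMem hξ, sub_zero]
        have h3 : R ≤ ‖ξ‖ := by simpa using hξ
        have h4 : r2 ≤ ‖ξ‖ ^ 2 := by
          rw [← hRR]; exact pow_le_pow_left₀ (Real.sqrt_nonneg _) h3 2
        have h5 : Real.exp (-s * ‖ξ‖ ^ 2) ≤ Real.exp (-(s * r2)) :=
          Real.exp_le_exp.2 (by nlinarith)
        nlinarith [h0 ξ, mul_nonneg (sub_nonneg.2 h5) (h0 ξ)]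
    have hz1 : s * r2 ≤ 1 := by
      rw [hr2, ← mul_div_assoc, div_le_one (by positivity)]; exact hz.le
    have he1 : s * r2 / 2 ≤ e := one_sub_exp_neg_ge (by positivity) hz1
    have hVr : Real.pi * r2 * A = V / 2 := by rw [hr2]; field_simp
    have hsV : s * V = 2 * Real.pi * A * (s * r2) := by rw [hr2]; field_simp
    rw [hVr] at key
    have k2 : v ≤ V * (1 - s * r2 / 4) := by nlinarith
    have hpA : 0 < Real.pi * A := by positivity
    rw [hsV]
    calc v * (8 * Real.pi * A + 2 * Real.pi * A * (s * r2))
        = v * (8 * (Real.pi * A) * (1 + s * r2 / 4)) := by ring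
      _ ≤ V * (1 - s * r2 / 4) * (8 * (Real.pi * A) * (1 + s * r2 / 4)) := by gcongr
      _ = 8 * Real.pi * A * V * (1 - (s * r2) ^ 2 / 16) := by ring
      _ ≤ 8 * Real.pi * A * V * 1 := by gcongr; nlinarith [sq_nonneg (s * r2)]
      _ = _ := by ring

/-- Measurable, nonnegative, bounded and integrable functions. -/
structure IsTame (f : Plane → ℝ) : Prop where
  measurable : Measurable f
  nonneg : ∀ x, 0 ≤ f x
  bounded : ∃ b, ∀ x, f x ≤ b
  integrable : Integrable f

theorem IsTame.memLp {f : Plane → ℝ} (hf : IsTame f) : MemLp f 2 := by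
  obtain ⟨b, hb⟩ := hf.bounded
  refine (memLp_two_iff_integrable_sq hf.measurable.aestronglyMeasurable).2
    ((hf.integrable.const_mul b).mono' (hf.measurable.pow_const 2).aestronglyMeasurable
      (Eventually.of_forall fun x => ?_))
  rw [Real.norm_of_nonneg (sq_nonneg _), sq]
  exact mul_le_mul_of_nonneg_right (hb x) (hf.nonneg x)

theorem IsTame.integrable_sq {f : Plane → ℝ} (hf : IsTame f) : Integrable fun x => f x ^ 2 :=
  hf.memLp.integrable_sq

/-- The average of `f` over translations distributed according to `ν`. -/
noncomputable def shiftAverage (ν : Measure Plane) (f : Plane → ℝ) (x : Plane) : ℝ :=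
  ∫ z, f (x + z) ∂ν

section shift

variable {ν : Measure Plane} [IsProbabilityMeasure ν] {f : Plane → ℝ}

theorem IsTame.integrable_prod_shift (hf : IsTame f) :
    Integrable (fun p : Plane × Plane => f (p.1 + p.2)) (volume.prod ν) := by
  have hm : Measurable fun p : Plane × Plane => f (p.1 + p.2) :=
    hf.measurable.comp (measurable_fst.add measurable_snd)
  rw [integrable_prod_iff' hm.aestronglyMeasurable]
  refine ⟨Eventually.of_forall fun z => hf.integrable.comp_add_right z, ?_⟩
  have : ∀ z : Plane, ∫ x, ‖f (x + z)‖ = ∫ x, ‖f x‖ := fun z =>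
    integral_add_right_eq_self (fun x => ‖f x‖) z
  simp only [this]
  exact integrable_const _

theorem IsTame.shiftAverage (hf : IsTame f) : IsTame (shiftAverage ν f) where
  measurable := by
    have hm : Measurable fun p : Plane × Plane => f (p.1 + p.2) :=
      hf.measurable.comp (measurable_fst.add measurable_snd)
    exact (hm.stronglyMeasurable.integral_prod_right (ν := ν)).measurable
  nonneg x := integral_nonneg fun z => hf.nonneg _
  bounded := by
    obtain ⟨b, hb⟩ := hf.bounded
    refine ⟨b, fun x => ?_⟩
    have := integral_mono_of_nonneg (μ := ν) (Eventually.of_forall fun z => hf.nonneg (x + z))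
      (integrable_const b) (Eventually.of_forall fun z => hb (x + z))
    simpa [_root_.shiftAverage] using this
  integrable := hf.integrable_prod_shift.integral_prod_left

theorem IsTame.integral_shiftAverage (hf : IsTame f) :
    ∫ x, _root_.shiftAverage ν f x = ∫ x, f x := by
  unfold _root_.shiftAverage
  rw [integral_integral_swap hf.integrable_prod_shift]
  have : ∀ z : Plane, ∫ x, f (x + z) = ∫ x, f x := fun z => integral_add_right_eq_self f z
  simp [this]

/-- Averaging `f(x + z)` instead of `f(x - z)` produces `charFun` without a conjugate; the factor
`2π` comes from the normalisation of `𝓕`. -/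
theorem IsTame.fourier_shiftAverage (hf : IsTame f) (ξ : Plane) :
    𝓕 (fun x => (_root_.shiftAverage ν f x : ℂ)) ξ
      = charFun ν ((2 * Real.pi) • ξ) * 𝓕 (fun x => (f x : ℂ)) ξ := by
  have e : ∀ x : Plane, Real.fourierChar (-inner ℝ x ξ) • ((_root_.shiftAverage ν f x : ℝ) : ℂ)
      = ∫ z, Real.fourierChar (-inner ℝ x ξ) • (f (x + z) : ℂ) ∂ν := fun x => by
    simp only [Circle.smul_def]
    rw [integral_smul, integral_complex_ofReal]; rfl
  have hsm : Integrable (fun p : Plane × Plane =>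
      Real.fourierChar (-inner ℝ p.1 ξ) • (f (p.1 + p.2) : ℂ)) (volume.prod ν) := by
    refine hf.integrable_prod_shift.norm.mono' ?_ (Eventually.of_forall fun p => by simp)
    refine Measurable.aestronglyMeasurable ?_
    have hm : Measurable fun p : Plane × Plane => f (p.1 + p.2) :=
      hf.measurable.comp (measurable_fst.add measurable_snd)
    have hc : Measurable fun p : Plane × Plane => ((Real.fourierChar (-inner ℝ p.1 ξ) : Circle) : ℂ) :=
      (by fun_prop : Continuous fun p : Plane × Plane =>
        ((Real.fourierChar (-inner ℝ p.1 ξ) : Circle) : ℂ)).measurable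
    simp only [Circle.smul_def, smul_eq_mul]
    exact hc.mul (Complex.measurable_ofReal.comp hm)
  rw [Real.fourier_eq]
  simp only [e]
  rw [integral_integral_swap hsm]
  have e2 : ∀ z : Plane, ∫ x, Real.fourierChar (-inner ℝ x ξ) • (f (x + z) : ℂ)
      = (Real.fourierChar (inner ℝ z ξ) : ℂ) * 𝓕 (fun x => (f x : ℂ)) ξ := fun z => by
    rw [← integral_sub_right_eq_self _ z, Real.fourier_eq, ← integral_const_mul]
    refine integral_congr_ae (Eventually.of_forall fun x => ?_)
    simp only [sub_add_cancel, Circle.smul_def, smul_eq_mul, inner_sub_left, neg_sub]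
    rw [sub_eq_add_neg, AddChar.map_add_eq_mul]
    push_cast
    ring
  simp only [e2]
  rw [integral_mul_const, charFun_apply]
  congr 1
  refine integral_congr_ae (Eventually.of_forall fun z => ?_)
  simp only [Real.fourierChar_apply, inner_smul_right]

theorem IsTame.ofReal_integrable (hf : IsTame f) : Integrable fun x => (f x : ℂ) :=
  hf.integrable.ofReal

theorem IsTame.ofReal_memLp (hf : IsTame f) : MemLp (fun x => (f x : ℂ)) 2 :=
  hf.memLp.ofReal

/-- One step of the Nash iteration for averages over a Gaussian of variance `h`. -/
theorem IsTame.nash_step (hf : IsTame f) {h : ℝ} (hh : 0 < h)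
    (hν : ∀ t, ‖charFun ν t‖ ^ 2 = Real.exp (-h * ‖t‖ ^ 2))
    {D : ℝ} (hD : 0 < D) (hfD : ∫ x, f x ≤ D) {q : ℝ}
    (hq : (∫ x, f x ^ 2) * q ≤ 1) :
    (∫ x, _root_.shiftAverage ν f x ^ 2) * (q + Real.pi * h / (2 * D ^ 2)) ≤ 1 := by
  have hpi := Real.pi_pos
  have hu : IsTame (_root_.shiftAverage ν f) := hf.shiftAverage
  set g : Plane → ℝ := fun ξ => ‖𝓕 (fun x => (f x : ℂ)) ξ‖ ^ 2 with hgdef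
  have hgint : Integrable g := (memLp_fourier hf.ofReal_integrable hf.ofReal_memLp).integrable_norm_pow
    (by norm_num)
  have hV : ∫ ξ, g ξ = ∫ x, f x ^ 2 := by
    rw [hgdef, integral_norm_sq_fourier hf.ofReal_integrable hf.ofReal_memLp]
    simp
  have hW : ∫ ξ, Real.exp (-(4 * Real.pi ^ 2 * h) * ‖ξ‖ ^ 2) * g ξ
      = ∫ x, _root_.shiftAverage ν f x ^ 2 := by
    have := integral_norm_sq_fourier hu.ofReal_integrable hu.ofReal_memLp
    simp only [Complex.norm_real, Real.norm_eq_abs, sq_abs] at this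
    rw [← this]
    refine integral_congr_ae (Eventually.of_forall fun ξ => ?_)
    simp only [hf.fourier_shiftAverage, norm_mul, mul_pow, hν, hgdef, norm_smul]
    congr 2
    rw [Real.norm_of_nonneg (by positivity), Real.norm_of_nonneg hpi.le]
    norm_num
    ring
  have hgA : ∀ ξ, g ξ ≤ D ^ 2 := fun ξ => by
    refine pow_le_pow_left₀ (norm_nonneg _) ((norm_fourier_le ξ).trans ?_) 2
    simp only [Complex.norm_real, Real.norm_of_nonneg (hf.nonneg _)]
    exact hfD
  -- Here `A = D²` because `|𝓕f| ≤ ∫ f ≤ D`, and `s = 4π²h` because `charFun` is evaluated at `2πξ`.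
  have key := integral_exp_mul_decay hgint (fun ξ => by positivity) (A := D ^ 2) (by positivity) hgA
    (s := 4 * Real.pi ^ 2 * h) (by positivity)
  rw [hW, hV] at key
  set W := ∫ x, _root_.shiftAverage ν f x ^ 2
  set V := ∫ x, f x ^ 2
  have hV0 : 0 ≤ V := integral_nonneg fun x => sq_nonneg _
  have hW0 : 0 ≤ W := integral_nonneg fun x => sq_nonneg _
  -- That is, `1/W ≥ 1/V + c` with `c = 4π²h/(8πD²)`. In the statement `q` plays the role of a lower
  -- bound for `1/V`, so that `V = 0` is allowed.
  have key2 : W * (1 + Real.pi * h / (2 * D ^ 2) * V) ≤ V := by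
    have : W * (1 + Real.pi * h / (2 * D ^ 2) * V) * (8 * Real.pi * D ^ 2)
        = W * (8 * Real.pi * D ^ 2 + 4 * Real.pi ^ 2 * h * V) := by field_simp; ring
    refine le_of_mul_le_mul_right (this.trans_le (key.trans_eq (by ring)))
      (by positivity : 0 < 8 * Real.pi * D ^ 2)
  set c := Real.pi * h / (2 * D ^ 2)
  have hc : 0 < c := by positivity
  rcases hV0.eq_or_lt with h0 | hVpos
  · rw [← h0] at key2
    have : W = 0 := by nlinarith
    simp [this]
  · have h1 : 0 < 1 + c * V := by positivity
    refine le_of_mul_le_mul_right (a := 1 + c * V) ?_ h1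
    have h5 : V * (q + c) ≤ 1 + c * V := by nlinarith
    rcases le_or_gt 0 (q + c) with h6 | h6
    · calc W * (q + c) * (1 + c * V) = W * (1 + c * V) * (q + c) := by ring
        _ ≤ V * (q + c) := by gcongr
        _ ≤ _ := by linarith
    · nlinarith [mul_nonneg hW0 (neg_nonneg.2 h6.le)]

end shift

/-! ### Random walks along almost volume-preserving maps -/

/-- `φ` and its inverse increase volumes at most by the factor `κ`. -/
structure DistortsVolumeBy (φ : Plane ≃ᵐ Plane) (κ : ℝ) : Prop where
  one_le : 1 ≤ κ
  map_le : (volume : Measure Plane).map φ ≤ ENNReal.ofReal κ • volume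
  map_symm_le : (volume : Measure Plane).map φ.symm ≤ ENNReal.ofReal κ • volume

theorem DistortsVolumeBy.symm {φ : Plane ≃ᵐ Plane} {κ : ℝ} (h : DistortsVolumeBy φ κ) :
    DistortsVolumeBy φ.symm κ :=
  ⟨h.one_le, h.map_symm_le, h.map_le⟩

theorem DistortsVolumeBy.comp {φ : Plane ≃ᵐ Plane} {κ : ℝ} (h : DistortsVolumeBy φ κ)
    {f : Plane → ℝ} (hf : Integrable f) (h0 : ∀ x, 0 ≤ f x) :
    Integrable (fun x => f (φ x)) ∧ ∫ x, f (φ x) ≤ κ * ∫ x, f x := by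
  have hs : Integrable f (ENNReal.ofReal κ • volume) := hf.smul_measure ENNReal.ofReal_ne_top
  have hm := hs.mono_measure h.map_le
  refine ⟨(integrable_map_equiv φ f).1 hm, ?_⟩
  rw [← integral_map_equiv φ f]
  refine (integral_mono_measure h.map_le (Eventually.of_forall h0) hs).trans ?_
  rw [integral_smul_measure, ENNReal.toReal_ofReal (zero_le_one.trans h.one_le), smul_eq_mul]

theorem IsTame.comp {φ : Plane ≃ᵐ Plane} {κ : ℝ} (h : DistortsVolumeBy φ κ)
    {f : Plane → ℝ} (hf : IsTame f) : IsTame fun x => f (φ x) where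
  measurable := hf.measurable.comp φ.measurable
  nonneg _ := hf.nonneg _
  bounded := hf.bounded.imp fun _ hb _ => hb _
  integrable := (h.comp hf.integrable hf.nonneg).1

theorem IsTame.mul {f g : Plane → ℝ} (hf : IsTame f) (hg : IsTame g) :
    Integrable fun x => f x * g x :=
  hf.memLp.integrable_mul hg.memLp

/-- Self-adjointness of the average: translate by `z`, then use the symmetry `z ↦ -z` of `ν`. -/
theorem IsTame.integral_shiftAverage_mul {ν : Measure Plane} [IsProbabilityMeasure ν]
    [ν.IsNegInvariant] {f g : Plane → ℝ} (hf : IsTame f) (hg : IsTame g) :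
    ∫ x, _root_.shiftAverage ν f x * g x = ∫ x, f x * _root_.shiftAverage ν g x := by
  obtain ⟨b, hb⟩ := hg.bounded
  have hmf : Measurable fun p : Plane × Plane => f (p.1 + p.2) :=
    hf.measurable.comp (measurable_fst.add measurable_snd)
  have hi : Integrable (fun p : Plane × Plane => f (p.1 + p.2) * g p.1) (volume.prod ν) := by
    refine (hf.integrable_prod_shift.mul_const b).mono'
      (hmf.mul (hg.measurable.comp measurable_fst)).aestronglyMeasurable
      (Eventually.of_forall fun p => ?_)
    rw [Real.norm_of_nonneg (mul_nonneg (hf.nonneg _) (hg.nonneg _))]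
    exact mul_le_mul_of_nonneg_left (hb _) (hf.nonneg _)
  obtain ⟨b', hb'⟩ := hf.bounded
  have hmg : Measurable fun p : Plane × Plane => g (p.1 + p.2) :=
    hg.measurable.comp (measurable_fst.add measurable_snd)
  have hj : Integrable (fun p : Plane × Plane => f p.1 * g (p.1 + p.2)) (volume.prod ν) := by
    refine (hg.integrable_prod_shift.const_mul b').mono'
      ((hf.measurable.comp measurable_fst).mul hmg).aestronglyMeasurable
      (Eventually.of_forall fun p => ?_)
    rw [Real.norm_of_nonneg (mul_nonneg (hf.nonneg _) (hg.nonneg _))]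
    exact mul_le_mul_of_nonneg_right (hb' _) (hg.nonneg _)
  unfold _root_.shiftAverage
  simp only [← integral_const_mul, ← integral_mul_const]
  refine (integral_integral_swap hi).trans (Eq.trans ?_ (integral_integral_swap hj).symm)
  rw [← integral_neg_eq_self]
  refine integral_congr_ae (Eventually.of_forall fun z => ?_)
  dsimp only
  rw [← integral_add_right_eq_self _ z]
  simp

section Walk

variable (ν : Measure Plane) (φ : Plane ≃ᵐ Plane)

/-- The transition operator of the walk `x ↦ φ x + z` with `z` distributed according to `ν`. -/
noncomputable def walkOp (f : Plane → ℝ) (x : Plane) : ℝ := shiftAverage ν f (φ x)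

/-- The dual of `walkOp`, up to the volume distortion of `φ`. -/
noncomputable def dualWalkOp (f : Plane → ℝ) (x : Plane) : ℝ :=
  shiftAverage ν (fun y => f (φ.symm y)) x

variable {ν φ} [IsProbabilityMeasure ν] {κ : ℝ}

theorem IsTame.walkOp (h : DistortsVolumeBy φ κ) {f : Plane → ℝ} (hf : IsTame f) :
    IsTame (walkOp ν φ f) :=
  hf.shiftAverage.comp h

theorem IsTame.dualWalkOp (h : DistortsVolumeBy φ κ) {f : Plane → ℝ} (hf : IsTame f) :
    IsTame (dualWalkOp ν φ f) :=
  (hf.comp h.symm).shiftAverage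

theorem IsTame.walkOp_iterate (h : DistortsVolumeBy φ κ) {f : Plane → ℝ} (hf : IsTame f) (k : ℕ) :
    IsTame ((_root_.walkOp ν φ)^[k] f) := by
  induction k with
  | zero => exact hf
  | succ k ih => rw [Function.iterate_succ_apply']; exact ih.walkOp h

theorem IsTame.dualWalkOp_iterate (h : DistortsVolumeBy φ κ) {f : Plane → ℝ} (hf : IsTame f)
    (k : ℕ) : IsTame ((_root_.dualWalkOp ν φ)^[k] f) := by
  induction k with
  | zero => exact hf
  | succ k ih => rw [Function.iterate_succ_apply']; exact ih.dualWalkOp h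

/-- In each step the change of variables by `φ` costs one factor `κ`, and the Gaussian average then
moves to the other function by self-adjointness. -/
theorem integral_walkOp_iterate_mul_le [ν.IsNegInvariant] (h : DistortsVolumeBy φ κ)
    {f g : Plane → ℝ} (hf : IsTame f) (hg : IsTame g) (k : ℕ) :
    ∫ x, (walkOp ν φ)^[k] f x * g x ≤ κ ^ k * ∫ x, f x * (dualWalkOp ν φ)^[k] g x := by
  have hκ : 0 ≤ κ := zero_le_one.trans h.one_le
  induction k generalizing g with
  | zero => simp
  | succ k ih =>
    have hT := hf.walkOp_iterate (ν := ν) h k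
    have h1 : ∫ x, (walkOp ν φ)^[k + 1] f x * g x
        ≤ κ * ∫ x, shiftAverage ν ((walkOp ν φ)^[k] f) x * g (φ.symm x) := by
      have := (h.comp (hT.shiftAverage.mul (hg.comp h.symm)) fun x =>
        mul_nonneg ((hT.shiftAverage (ν := ν)).nonneg x) (hg.nonneg _)).2
      simpa [Function.iterate_succ_apply', walkOp] using this
    rw [hT.integral_shiftAverage_mul (hg.comp h.symm)] at h1
    refine h1.trans ?_
    have h2 := ih (hg.dualWalkOp (ν := ν) h)
    rw [Function.iterate_succ_apply, pow_succ', mul_assoc]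
    exact mul_le_mul_of_nonneg_left h2 hκ

/-- Composition with `φ` multiplies mass and squared `L²` norm by at most `κ`. So the mass stays
below `κ^n ≤ 2`, and the Nash step with `D = 2` adds `πs/8` to the inverse squared norm each time.
The accumulated distortion halves the final constant to `πs/16`. -/
theorem integral_sq_walkOp_iterate_le (h : DistortsVolumeBy φ κ) {s : ℝ} (hs : 0 < s)
    (hν : ∀ t, ‖charFun ν t‖ ^ 2 = Real.exp (-s * ‖t‖ ^ 2)) {f : Plane → ℝ} (hf : IsTame f)
    (hf1 : ∫ x, f x ≤ 1) {n : ℕ} (hn : κ ^ n ≤ 2) :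
    (∫ x, (walkOp ν φ)^[n] f x ^ 2) * (n * (Real.pi * s / 16)) ≤ 1 := by
  have hκ0 : 0 < κ := zero_lt_one.trans_le h.one_le
  have hpi := Real.pi_pos
  have main : ∀ k ≤ n, ∫ x, (walkOp ν φ)^[k] f x ≤ κ ^ k ∧
      (∫ x, (walkOp ν φ)^[k] f x ^ 2) * (k * (Real.pi * s / 8) / κ ^ k) ≤ 1 := by
    intro k
    induction k with
    | zero => intro _; simpa using hf1
    | succ k ih =>
      intro hk
      obtain ⟨i1, i2⟩ := ih (by omega)
      have hT := hf.walkOp_iterate (ν := ν) h k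
      have hk2 : κ ^ k ≤ 2 := (pow_le_pow_right₀ h.one_le (by omega)).trans hn
      simp only [Function.iterate_succ_apply']
      set u := (walkOp ν φ)^[k] f
      have l1 := (h.comp hT.shiftAverage.integrable (hT.shiftAverage (ν := ν)).nonneg).2
      rw [hT.integral_shiftAverage] at l1
      have l2 := (h.comp hT.shiftAverage.integrable_sq
        (fun x => sq_nonneg (shiftAverage ν u x))).2
      have l3 := hT.nash_step hs hν two_pos (i1.trans hk2) i2
      refine ⟨l1.trans ?_, ?_⟩
      · rw [pow_succ']; gcongr
      · have hc : Real.pi * s / (2 * 2 ^ 2) = Real.pi * s / 8 := by norm_num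
        rw [hc] at l3
        set W := ∫ x, shiftAverage ν u x ^ 2
        have hW : 0 ≤ W := integral_nonneg fun x => sq_nonneg _
        have e : ((k + 1 : ℕ) : ℝ) * (Real.pi * s / 8) / κ ^ (k + 1)
            ≤ (k * (Real.pi * s / 8) / κ ^ k + Real.pi * s / 8) / κ := by
          have : Real.pi * s / 8 / κ ^ k ≤ Real.pi * s / 8 :=
            div_le_self (by positivity) (one_le_pow₀ h.one_le)
          rw [pow_succ, ← div_div]
          gcongr
          push_cast
          rw [add_mul, add_div, one_mul]
          gcongr
        calc (∫ x, walkOp ν φ u x ^ 2) * (((k + 1 : ℕ) : ℝ) * (Real.pi * s / 8) / κ ^ (k + 1))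
            ≤ (κ * W) * ((k * (Real.pi * s / 8) / κ ^ k + Real.pi * s / 8) / κ) := by
              refine mul_le_mul l2 e (by positivity) (by positivity)
          _ = W * (k * (Real.pi * s / 8) / κ ^ k + Real.pi * s / 8) := by field_simp
          _ ≤ 1 := l3
  refine le_trans ?_ (main n le_rfl).2
  refine mul_le_mul_of_nonneg_left ?_ (integral_nonneg fun x => sq_nonneg _)
  rw [le_div_iff₀ (by positivity)]
  calc n * (Real.pi * s / 16) * κ ^ n ≤ n * (Real.pi * s / 16) * 2 := by gcongr
    _ = _ := by ring

/-- In the dual walk the distortion precedes the average, so it has to be absorbed before the Nash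
step is applied. -/
theorem integral_sq_dualWalkOp_iterate_le (h : DistortsVolumeBy φ κ) {s : ℝ} (hs : 0 < s)
    (hν : ∀ t, ‖charFun ν t‖ ^ 2 = Real.exp (-s * ‖t‖ ^ 2)) {f : Plane → ℝ} (hf : IsTame f)
    (hf1 : ∫ x, f x ≤ 1) {n : ℕ} (hn : κ ^ n ≤ 2) :
    (∫ x, (dualWalkOp ν φ)^[n] f x ^ 2) * (n * (Real.pi * s / 16)) ≤ 1 := by
  have hκ0 : 0 < κ := zero_lt_one.trans_le h.one_le
  have hpi := Real.pi_pos
  have main : ∀ k ≤ n, ∫ x, (dualWalkOp ν φ)^[k] f x ≤ κ ^ k ∧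
      (∫ x, (dualWalkOp ν φ)^[k] f x ^ 2) * (k * (Real.pi * s / 8) / κ ^ k) ≤ 1 := by
    intro k
    induction k with
    | zero => intro _; simpa using hf1
    | succ k ih =>
      intro hk
      obtain ⟨i1, i2⟩ := ih (by omega)
      have hT := hf.dualWalkOp_iterate (ν := ν) h k
      have hk2 : κ ^ (k + 1) ≤ 2 := (pow_le_pow_right₀ h.one_le (by omega)).trans hn
      simp only [Function.iterate_succ_apply']
      set u := (dualWalkOp ν φ)^[k] f
      have l1 : ∫ x, u (φ.symm x) ≤ κ ^ (k + 1) := by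
        refine (h.symm.comp hT.integrable hT.nonneg).2.trans ?_
        rw [pow_succ']; gcongr
      have l2 := (h.symm.comp hT.integrable_sq (fun x => sq_nonneg (u x))).2
      have l0 : (∫ x, u (φ.symm x) ^ 2) * (k * (Real.pi * s / 8) / κ ^ (k + 1)) ≤ 1 := by
        calc _ ≤ (κ * ∫ x, u x ^ 2) * (k * (Real.pi * s / 8) / κ ^ (k + 1)) := by gcongr
          _ = (∫ x, u x ^ 2) * (k * (Real.pi * s / 8) / κ ^ k) := by
            rw [pow_succ]; field_simp
          _ ≤ 1 := i2
      have l3 := (hT.comp h.symm).nash_step hs hν two_pos (l1.trans hk2) l0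
      refine ⟨((hT.comp h.symm).integral_shiftAverage (ν := ν)).trans_le l1, le_trans ?_ l3⟩
      refine mul_le_mul_of_nonneg_left ?_ (integral_nonneg fun x => sq_nonneg _)
      have : Real.pi * s / 8 / κ ^ (k + 1) ≤ Real.pi * s / 8 :=
        div_le_self (by positivity) (one_le_pow₀ h.one_le)
      push_cast
      rw [add_mul, add_div, one_mul]
      norm_num at this ⊢
      linarith
  refine le_trans ?_ (main n le_rfl).2
  refine mul_le_mul_of_nonneg_left ?_ (integral_nonneg fun x => sq_nonneg _)
  rw [le_div_iff₀ (by positivity)]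
  calc n * (Real.pi * s / 16) * κ ^ n ≤ n * (Real.pi * s / 16) * 2 := by gcongr
    _ = _ := by ring

/-- On-diagonal bound for the walk of `2 n` steps of variance `s`. -/
theorem integral_walkOp_mul_le [ν.IsNegInvariant] (h : DistortsVolumeBy φ κ) {s : ℝ} (hs : 0 < s)
    (hν : ∀ t, ‖charFun ν t‖ ^ 2 = Real.exp (-s * ‖t‖ ^ 2)) {f g : Plane → ℝ} (hf : IsTame f)
    (hg : IsTame g) (hf1 : ∫ x, f x ≤ 1) (hg1 : ∫ x, g x ≤ 1) {n : ℕ} (hn0 : 0 < n)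
    (hn : κ ^ n ≤ 2) :
    ∫ x, (walkOp ν φ)^[n + n] f x * g x ≤ 64 / (Real.pi * ((n + n : ℕ) * s)) := by
  have hκ0 : 0 < κ := zero_lt_one.trans_le h.one_le
  have hpi := Real.pi_pos
  have hF := hf.walkOp_iterate (ν := ν) h n
  have hG := hg.dualWalkOp_iterate (ν := ν) h n
  have a1 := integral_sq_walkOp_iterate_le h hs hν hf hf1 hn
  have a2 := integral_sq_dualWalkOp_iterate_le h hs hν hg hg1 hn
  have a3 := integral_walkOp_iterate_mul_le (ν := ν) h hF hg n
  rw [← Function.iterate_add_apply] at a3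
  set F := (walkOp ν φ)^[n] f
  set G := (dualWalkOp ν φ)^[n] g
  have a4 : ∫ x, F x * G x ≤ (∫ x, F x ^ 2) / 2 + (∫ x, G x ^ 2) / 2 := by
    rw [← integral_div, ← integral_div, ← integral_add (hF.integrable_sq.div_const 2)
      (hG.integrable_sq.div_const 2)]
    refine integral_mono (hF.mul hG) ((hF.integrable_sq.div_const 2).add
      (hG.integrable_sq.div_const 2)) fun x => ?_
    have := two_mul_le_add_sq (F x) (G x)
    dsimp only [Pi.add_apply]
    linarith
  have hn' : (0 : ℝ) < n := by exact_mod_cast hn0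
  have hc : 0 < n * (Real.pi * s / 16) := by positivity
  rw [← le_div_iff₀ hc] at a1 a2
  have hFG : 0 ≤ ∫ x, F x * G x := integral_nonneg fun x => mul_nonneg (hF.nonneg x) (hG.nonneg x)
  -- Both squared norms are at most `16/(nπs)` and `κ^n ≤ 2`, giving `32/(nπs)`. This is `64/π`
  -- divided by the total variance `2ns`.
  calc _ ≤ κ ^ n * ∫ x, F x * G x := a3
    _ ≤ 2 * ∫ x, F x * G x := by gcongr
    _ ≤ 2 * (1 / (n * (Real.pi * s / 16))) := by linarith
    _ = _ := by push_cast; field_simp; norm_num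

end Walk

/-! ### The skew gradient and its Euler map -/

theorem gradient_apply (H : Plane → ℝ) (x : Plane) (i : Fin 2) :
    gradient H x i = fderiv ℝ H x (EuclideanSpace.single i 1) := by
  rw [gradient, ← InnerProductSpace.toDual_symm_apply (𝕜 := ℝ), EuclideanSpace.inner_single_right]
  simp

section Hamiltonian

variable {H : Plane → ℝ} (hH : IsGenericHamiltonian H)
include hH

theorem IsGenericHamiltonian.differentiable_fderiv : Differentiable ℝ (fderiv ℝ H) :=
  ((hH.contDiff.of_le (by norm_num : (2 : WithTop ℕ∞) ≤ 4)).fderiv_right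
    (m := 1) (by norm_num)).differentiable (by norm_num)

theorem IsGenericHamiltonian.exists_norm_fderiv_fderiv_le :
    ∃ K : ℝ, 0 ≤ K ∧ ∀ x, ‖fderiv ℝ (fderiv ℝ H) x‖ ≤ K := by
  obtain ⟨K, hK⟩ := hH.bounded_second
  have h : ∀ x, ‖fderiv ℝ (fderiv ℝ H) x‖ ≤ K := fun x => by
    rw [← norm_iteratedFDeriv_one, norm_iteratedFDeriv_fderiv]
    exact hK x
  exact ⟨K, (norm_nonneg (fderiv ℝ (fderiv ℝ H) 0)).trans (h 0), h⟩

theorem IsGenericHamiltonian.fderiv_fderiv_symm (x v w : Plane) :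
    fderiv ℝ (fderiv ℝ H) x v w = fderiv ℝ (fderiv ℝ H) x w v :=
  (hH.contDiff.contDiffAt.isSymmSndFDerivAt (by simp; norm_num)) v w

/-- The derivative of the skew gradient. -/
noncomputable def skewHessian (H : Plane → ℝ) (x : Plane) : Plane →L[ℝ] Plane :=
  ((EuclideanSpace.equiv (Fin 2) ℝ).symm : (Fin 2 → ℝ) →L[ℝ] Plane).comp
    (ContinuousLinearMap.pi ![(fderiv ℝ (fderiv ℝ H) x).flip (EuclideanSpace.single 1 1),
      -(fderiv ℝ (fderiv ℝ H) x).flip (EuclideanSpace.single 0 1)])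

omit hH in
theorem skewGradient_eq (x : Plane) : skewGradient H x =
    !₂[fderiv ℝ H x (EuclideanSpace.single 1 1), -fderiv ℝ H x (EuclideanSpace.single 0 1)] := by
  rw [skewGradient, gradient_apply, gradient_apply]

theorem IsGenericHamiltonian.hasFDerivAt_skewGradient (x : Plane) :
    HasFDerivAt (skewGradient H) (skewHessian H x) x := by
  have h := (hH.differentiable_fderiv x).hasFDerivAt
  have h0 := h.clm_apply (hasFDerivAt_const (EuclideanSpace.single (0 : Fin 2) (1 : ℝ)) x)
  have h1 := h.clm_apply (hasFDerivAt_const (EuclideanSpace.single (1 : Fin 2) (1 : ℝ)) x)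
  rw [← hasFDerivWithinAt_univ, hasFDerivWithinAt_euclidean]
  intro i
  fin_cases i
  · refine ((h1.congr_of_eventuallyEq (Eventually.of_forall fun y => ?_)).congr_fderiv ?_).hasFDerivWithinAt
    · simp [skewGradient_eq]
    · ext v; simp [skewHessian]
  · refine ((h0.neg.congr_of_eventuallyEq (Eventually.of_forall fun y => ?_)).congr_fderiv ?_).hasFDerivWithinAt
    · simp [skewGradient_eq]
    · ext v; simp [skewHessian]

omit hH in
theorem norm_skewGradient_sub (x y : Plane) :
    ‖skewGradient H x - skewGradient H y‖ = ‖gradient H x - gradient H y‖ := by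
  rw [EuclideanSpace.norm_eq, EuclideanSpace.norm_eq]
  simp only [Fin.sum_univ_two, skewGradient, PiLp.sub_apply, Real.norm_eq_abs, sq_abs]
  congr 1
  simp
  ring

theorem IsGenericHamiltonian.norm_skewGradient_sub_le {K : ℝ}
    (hK : ∀ x, ‖fderiv ℝ (fderiv ℝ H) x‖ ≤ K) (x y : Plane) :
    ‖skewGradient H x - skewGradient H y‖ ≤ K * ‖x - y‖ := by
  rw [norm_skewGradient_sub, gradient, gradient, ← map_sub, LinearIsometryEquiv.norm_map]
  exact Convex.norm_image_sub_le_of_norm_fderiv_le (𝕜 := ℝ) (s := univ)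
    (fun z _ => hH.differentiable_fderiv z) (fun z _ => hK z) convex_univ (mem_univ y) (mem_univ x)

/-- The derivative of a Hamiltonian field has trace zero, so in dimension two the determinant is
exactly `1 + r² det D²H`. The missing linear term is what makes the distortion of `n` steps of size
`1/n` tend to `1`. -/
theorem IsGenericHamiltonian.abs_det_sub_one_le {K : ℝ}
    (hK : ∀ x, ‖fderiv ℝ (fderiv ℝ H) x‖ ≤ K) (r : ℝ) (x : Plane) :
    |(ContinuousLinearMap.id ℝ Plane + r • skewHessian H x).det - 1| ≤ 2 * (r * K) ^ 2 := by
  set S := fderiv ℝ (fderiv ℝ H) x with hS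
  have hb : ∀ i j : Fin 2, |S (EuclideanSpace.single i 1) (EuclideanSpace.single j 1)| ≤ K := by
    intro i j
    have := S.le_opNorm₂ (EuclideanSpace.single i 1) (EuclideanSpace.single j 1)
    simp only [PiLp.norm_single, norm_one, mul_one] at this
    exact this.trans (hK x)
  have hsym := hH.fderiv_fderiv_symm x (EuclideanSpace.single 0 1) (EuclideanSpace.single 1 1)
  have e : (ContinuousLinearMap.id ℝ Plane + r • skewHessian H x).det - 1
      = r ^ 2 * (S (EuclideanSpace.single 0 1) (EuclideanSpace.single 0 1)
          * S (EuclideanSpace.single 1 1) (EuclideanSpace.single 1 1)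
        - S (EuclideanSpace.single 0 1) (EuclideanSpace.single 1 1) ^ 2) := by
    rw [ContinuousLinearMap.det, ← LinearMap.det_toMatrix (EuclideanSpace.basisFun (Fin 2) ℝ).toBasis,
      Matrix.det_fin_two]
    simp only [LinearMap.toMatrix_apply]
    simp [skewHessian, ← hS]
    rw [← hS] at hsym
    rw [hsym]
    ring
  rw [e, abs_mul, abs_of_nonneg (sq_nonneg r), mul_pow]
  have h2 : ∀ a b c : ℝ, |a| ≤ K → |b| ≤ K → |c| ≤ K → |a * b - c ^ 2| ≤ 2 * K ^ 2 := by
    intro a b c ha hb hc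
    calc |a * b - c ^ 2| ≤ |a * b| + |c ^ 2| := abs_sub _ _
      _ = |a| * |b| + |c| ^ 2 := by rw [abs_mul, abs_pow]
      _ ≤ K * K + K ^ 2 := by
        have : 0 ≤ K := (abs_nonneg a).trans ha
        gcongr
      _ = _ := by ring
  calc r ^ 2 * _ ≤ r ^ 2 * (2 * K ^ 2) :=
        mul_le_mul_of_nonneg_left (h2 _ _ _ (hb 0 0) (hb 1 1) (hb 0 1)) (sq_nonneg r)
    _ = _ := by ring

/-- The Euler map `x ↦ x + r ∇^⊥ H(x)` is a homeomorphism for small `r` that nearly preserves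
volumes. -/
theorem IsGenericHamiltonian.exists_eulerMap {K : ℝ} (hK0 : 0 ≤ K)
    (hK : ∀ x, ‖fderiv ℝ (fderiv ℝ H) x‖ ≤ K) {r : ℝ} (hr : 0 ≤ r) (hrK : r * K ≤ 1 / 2) :
    ∃ φ : Plane ≃ᵐ Plane, (∀ x, φ x = x + r • skewGradient H x) ∧
      DistortsVolumeBy φ (1 + 4 * (r * K) ^ 2) := by
  set f : Plane → Plane := fun x => x + r • skewGradient H x with hf
  -- A perturbation of the identity with Lipschitz constant `r K < 1` is a homeomorphism of the
  -- whole plane.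
  have hap : ApproximatesLinearOn f ((ContinuousLinearEquiv.refl ℝ Plane : Plane ≃L[ℝ] Plane) :
      Plane →L[ℝ] Plane) univ (r * K).toNNReal := by
    intro x _ y _
    have : f x - f y - (x - y) = r • (skewGradient H x - skewGradient H y) := by
      simp only [hf, smul_sub]; abel
    simp only [ContinuousLinearEquiv.coe_refl, ContinuousLinearMap.coe_id', id]
    rw [this, norm_smul, Real.norm_of_nonneg hr,
      Real.coe_toNNReal _ (by positivity), mul_assoc]
    exact mul_le_mul_of_nonneg_left (hH.norm_skewGradient_sub_le hK x y) hr
  have hsmall : ((r * K).toNNReal : ℝ≥0)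
      < ‖((ContinuousLinearEquiv.refl ℝ Plane).symm : Plane →L[ℝ] Plane)‖₊⁻¹ := by
    rw [← NNReal.coe_lt_coe]
    simp only [ContinuousLinearEquiv.refl_symm, ContinuousLinearEquiv.coe_refl, NNReal.coe_inv,
      coe_nnnorm, ContinuousLinearMap.norm_id, Real.coe_toNNReal (r * K) (by positivity)]
    norm_num
    linarith
  set Φ : Plane ≃ₜ Plane := hap.toHomeomorph f (Or.inr hsmall) with hΦ
  have hΦf : ∀ x, Φ x = f x := fun x => rfl
  have hinj : InjOn f univ := fun x _ y _ hxy => Φ.injective (by rw [hΦf, hΦf, hxy])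
  have hder : ∀ s : Set Plane, ∀ x ∈ s, HasFDerivWithinAt f
      (ContinuousLinearMap.id ℝ Plane + r • skewHessian H x) s x := fun s x _ =>
    ((hasFDerivAt_id x).add ((hH.hasFDerivAt_skewGradient x).const_smul r)).hasFDerivWithinAt
  set η := 2 * (r * K) ^ 2 with hη
  have hη0 : 0 ≤ η := by positivity
  have hη1 : η ≤ 1 / 2 := by
    have : (r * K) ^ 2 ≤ (1 / 2) ^ 2 := pow_le_pow_left₀ (by positivity) hrK 2
    rw [hη]; linarith
  have hdet := fun x => abs_le.1 (hH.abs_det_sub_one_le hK r x)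
  have hvol : ∀ s : Set Plane, MeasurableSet s →
      ∫⁻ x in s, ENNReal.ofReal |(ContinuousLinearMap.id ℝ Plane + r • skewHessian H x).det|
        = volume (f '' s) := fun s hs =>
    lintegral_abs_det_fderiv_eq_addHaar_image volume hs (hder s) (hinj.mono (subset_univ s))
  -- The Jacobian lies in `[1 - η, 1 + η]`, and `1 + 2η` dominates both `1 + η` and, as `η ≤ 1/2`,
  -- also `1/(1 - η)`.
  have hκ : (1 : ℝ) + 4 * (r * K) ^ 2 = 1 + 2 * η := by rw [hη]; ring
  refine ⟨Φ.toMeasurableEquiv, fun x => rfl, by rw [hκ]; linarith, ?_, ?_⟩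
  · refine Measure.le_iff.2 fun s hs => ?_
    rw [MeasurableEquiv.map_apply, Measure.smul_apply, smul_eq_mul]
    have hA : MeasurableSet (Φ.toMeasurableEquiv ⁻¹' s) := Φ.toMeasurableEquiv.measurable hs
    have hv := hvol _ hA
    have him : f '' (Φ.toMeasurableEquiv ⁻¹' s) = s := image_preimage_eq s Φ.surjective
    rw [him] at hv
    have hle : ENNReal.ofReal (1 - η) * volume (Φ.toMeasurableEquiv ⁻¹' s) ≤ volume s := by
      rw [← hv, ← setLIntegral_const]
      refine lintegral_mono fun x => ENNReal.ofReal_le_ofReal (le_trans ?_ (le_abs_self _))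
      linarith [(hdet x).1]
    calc volume (Φ.toMeasurableEquiv ⁻¹' s)
        = ENNReal.ofReal 1 * volume (Φ.toMeasurableEquiv ⁻¹' s) := by simp
      _ ≤ ENNReal.ofReal ((1 + 4 * (r * K) ^ 2) * (1 - η))
          * volume (Φ.toMeasurableEquiv ⁻¹' s) := by
        gcongr
        rw [hκ]; nlinarith
      _ = ENNReal.ofReal (1 + 4 * (r * K) ^ 2)
          * (ENNReal.ofReal (1 - η) * volume (Φ.toMeasurableEquiv ⁻¹' s)) := by
        rw [ENNReal.ofReal_mul (by positivity), mul_assoc]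
      _ ≤ _ := by gcongr
  · refine Measure.le_iff.2 fun s hs => ?_
    rw [MeasurableEquiv.map_apply, Measure.smul_apply, smul_eq_mul]
    have him : Φ.toMeasurableEquiv.symm ⁻¹' s = f '' s := (Φ.toEquiv.image_eq_preimage_symm s).symm
    rw [him, ← hvol s hs, ← setLIntegral_const]
    refine lintegral_mono fun x => ENNReal.ofReal_le_ofReal ?_
    rw [hκ, abs_le]
    constructor <;> linarith [(hdet x).1, (hdet x).2]

end Hamiltonian

/-! ### The Euler scheme along a path -/

/-- The iterates of `φ` perturbed by the increments of `β`. -/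
def eulerPath (φ : Plane → Plane) (x : Plane) (β : ℕ → Plane) : ℕ → Plane
  | 0 => x
  | k + 1 => φ (eulerPath φ x β k) + (β (k + 1) - β k)

theorem eulerPath_congr {φ : Plane → Plane} {x : Plane} {β β' : ℕ → Plane} {k : ℕ}
    (h : ∀ j ≤ k, β j = β' j) : eulerPath φ x β k = eulerPath φ x β' k := by
  induction k with
  | zero => rfl
  | succ k ih =>
    rw [eulerPath, eulerPath, ih fun j hj => h j (by omega), h (k + 1) le_rfl, h k (by omega)]

theorem measurable_eulerPath {α : Type*} [MeasurableSpace α] {φ : Plane → Plane}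
    (hφ : Measurable φ) (x : Plane) {β : α → ℕ → Plane} (hβ : ∀ j, Measurable fun a => β a j)
    (k : ℕ) : Measurable fun a => eulerPath φ x (β a) k := by
  induction k with
  | zero => exact measurable_const
  | succ k ih => exact (hφ.comp ih).add ((hβ (k + 1)).sub (hβ k))

theorem norm_eulerPath_sub_le {φ : Plane → Plane} {ℓ : ℝ} (hℓ : 0 ≤ ℓ)
    (hφ : ∀ x y, ‖φ x - φ y‖ ≤ ℓ * ‖x - y‖) (β : ℕ → Plane) (x y : Plane) (k : ℕ) :
    ‖eulerPath φ x β k - eulerPath φ y β k‖ ≤ ℓ ^ k * ‖x - y‖ := by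
  induction k with
  | zero => simp [eulerPath]
  | succ k ih =>
    simp only [eulerPath, add_sub_add_right_eq_sub]
    refine (hφ _ _).trans ?_
    rw [pow_succ', mul_assoc]
    gcongr

section Convergence

variable {c : Plane → Plane} {L : ℝ} (hL : 0 ≤ L) (hc : ∀ x y, ‖c x - c y‖ ≤ L * ‖x - y‖)
  {Z w : ℝ → Plane} (hZ : Continuous Z) {x : Plane}
  (heq : ∀ s : ℝ, 0 ≤ s → Z s = x + (∫ u in (0 : ℝ)..s, c (Z u)) + w s) (hw : w 0 = 0)
include hL hc hZ heq hw

/-- The additive noise cancels in the difference, so the comparison is deterministic. The error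
obeys `e_{k+1} ≤ (1 + hL) e_k + hLη`, with `η` the oscillation of `Z` within a step, and a discrete
Gronwall argument applies. -/
theorem norm_sub_eulerPath_le {h η : ℝ} (hh : 0 ≤ h) (N : ℕ)
    (hosc : ∀ k < N, ∀ u ∈ Icc ((k : ℝ) * h) ((k + 1 : ℕ) * h), ‖Z u - Z (k * h)‖ ≤ η) :
    ‖Z (N * h) - eulerPath (fun y => y + h • c y) x (fun k => w (k * h)) N‖
      ≤ η * ((1 + h * L) ^ N - 1) := by
  have hcc : Continuous c := by
    have : LipschitzWith L.toNNReal c := LipschitzWith.of_dist_le_mul fun a b => by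
      rw [dist_eq_norm, dist_eq_norm, Real.coe_toNNReal L hL]; exact hc a b
    exact this.continuous
  have hcZ : Continuous fun u => c (Z u) := hcc.comp hZ
  set Y := eulerPath (fun y => y + h • c y) x (fun k => w (k * h)) with hY
  suffices H : ∀ k ≤ N, ‖Z (k * h) - Y k‖ ≤ η * ((1 + h * L) ^ k - 1) from H N le_rfl
  intro k
  induction k with
  | zero => intro _; simp [hY, eulerPath, heq 0 le_rfl, hw]
  | succ k ih =>
    intro hk
    have ih := ih (by omega)
    have hkh : (k : ℝ) * h ≤ (k + 1 : ℕ) * h := by gcongr; simp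
    have hlen : ((k + 1 : ℕ) : ℝ) * h - k * h = h := by push_cast; ring
    have e1 : Z ((k + 1 : ℕ) * h) - Z (k * h)
        = (∫ u in (k : ℝ) * h..(k + 1 : ℕ) * h, c (Z u)) + (w ((k + 1 : ℕ) * h) - w (k * h)) := by
      rw [heq _ (by positivity), heq (k * h) (by positivity),
        ← intervalIntegral.integral_add_adjacent_intervals (a := 0) (b := k * h)
          (hcZ.intervalIntegrable _ _) (hcZ.intervalIntegrable _ _)]
      abel
    have e2 : Z ((k + 1 : ℕ) * h) - Y (k + 1) = (Z (k * h) - Y k)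
        + ∫ u in (k : ℝ) * h..(k + 1 : ℕ) * h, (c (Z u) - c (Y k)) := by
      rw [intervalIntegral.integral_sub (hcZ.intervalIntegrable _ _) (by simp),
        intervalIntegral.integral_const, hlen, ← sub_add_cancel (Z ((k + 1 : ℕ) * h)) (Z (k * h)),
        e1]
      simp only [hY, eulerPath]
      abel
    have e3 : ‖∫ u in (k : ℝ) * h..(k + 1 : ℕ) * h, (c (Z u) - c (Y k))‖
        ≤ L * (η + ‖Z (k * h) - Y k‖) * |((k + 1 : ℕ) : ℝ) * h - k * h| := by
      refine intervalIntegral.norm_integral_le_of_norm_le_const fun u hu => ?_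
      rw [uIoc_of_le hkh] at hu
      refine (hc _ _).trans (mul_le_mul_of_nonneg_left ?_ hL)
      calc ‖Z u - Y k‖ = ‖(Z u - Z (k * h)) + (Z (k * h) - Y k)‖ := by congr 1; abel
        _ ≤ _ := (norm_add_le _ _).trans (by gcongr; exact hosc k (by omega) u ⟨hu.1.le, hu.2⟩)
    rw [hlen, abs_of_nonneg hh] at e3
    rw [e2]
    refine (norm_add_le _ _).trans ?_
    have : 0 ≤ h * L := by positivity
    calc _ ≤ ‖Z (k * h) - Y k‖ + L * (η + ‖Z (k * h) - Y k‖) * h := by gcongr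
      _ = ‖Z (k * h) - Y k‖ * (1 + h * L) + h * L * η := by ring
      _ ≤ η * ((1 + h * L) ^ k - 1) * (1 + h * L) + h * L * η := by gcongr
      _ = _ := by ring

theorem tendsto_eulerPath {t : ℝ} (ht : 0 ≤ t) :
    Tendsto (fun n : ℕ => eulerPath (fun y => y + (t / n) • c y) x (fun k => w (k * (t / n))) n)
      atTop (𝓝 (Z t)) := by
  rw [tendsto_iff_norm_sub_tendsto_zero]
  simp only [norm_sub_rev _ (Z t)]
  have huc : UniformContinuousOn Z (Icc 0 t) :=
    isCompact_Icc.uniformContinuousOn_of_continuous hZ.continuousOn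
  rw [Metric.tendsto_atTop]
  intro e he
  -- The exponential offsets the Gronwall factor `(1 + tL/n)^n`; the `2` makes the final inequality
  -- strict.
  set η := e / (Real.exp (t * L)) / 2 with hη
  have hη0 : 0 < η := by positivity
  obtain ⟨d, hd, hud⟩ := Metric.uniformContinuousOn_iff.1 huc η hη0
  obtain ⟨N, hN⟩ := exists_nat_gt (t / d)
  refine ⟨N + 1, fun n hn => ?_⟩
  have hn0 : (0 : ℝ) < n := by exact_mod_cast (show 0 < n by omega)
  have hNn : (N : ℝ) ≤ n := by exact_mod_cast (show N ≤ n by omega)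
  have hh : t / n < d := by
    rw [div_lt_iff₀ hn0]; rw [div_lt_iff₀ hd] at hN; nlinarith
  have hh0 : 0 ≤ t / n := by positivity
  have key := norm_sub_eulerPath_le hL hc hZ heq hw hh0 n (by
    intro k hk u hu
    have hk1 : ((k + 1 : ℕ) : ℝ) ≤ n := by exact_mod_cast hk
    have hu1 : u ≤ t := hu.2.trans (by
      calc ((k + 1 : ℕ) : ℝ) * (t / n) ≤ n * (t / n) := by gcongr
        _ = t := by field_simp)
    have hk0 : 0 ≤ (k : ℝ) * (t / n) := by positivity
    rw [← dist_eq_norm]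
    refine (hud u ⟨hk0.trans hu.1, hu1⟩ (k * (t / n)) ⟨hk0, hu.1.trans hu1⟩ ?_).le
    rw [Real.dist_eq, abs_of_nonneg (sub_nonneg.2 hu.1)]
    have := hu.2
    push_cast at this
    linarith)
  have e1 : (n : ℝ) * (t / n) = t := by field_simp
  rw [e1] at key
  rw [Real.dist_eq, sub_zero, abs_of_nonneg (norm_nonneg _)]
  have e2 : (1 + t / n * L) ^ n ≤ Real.exp (t * L) := by
    calc (1 + t / n * L) ^ n ≤ (Real.exp (t / n * L)) ^ n := by
          gcongr; rw [add_comm]; exact Real.add_one_le_exp _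
      _ = Real.exp (t * L) := by rw [← Real.exp_nat_mul]; congr 1; field_simp
  calc _ ≤ η * ((1 + t / n * L) ^ n - 1) := key
    _ ≤ η * Real.exp (t * L) := by gcongr; linarith
    _ = e / 2 := by rw [hη]; field_simp
    _ < e := half_lt_self he

end Convergence

/-! ### The law of the Euler scheme -/

/-- The centred Gaussian measure on the plane with covariance `h I`. -/
noncomputable def planeGaussian (h : ℝ≥0) : Measure Plane :=
  ((gaussianReal 0 h).prod (gaussianReal 0 h)).map fun p => !₂[p.1, p.2]

theorem measurable_vec : Measurable fun p : ℝ × ℝ => (!₂[p.1, p.2] : Plane) := by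
  refine (WithLp.measurable_toLp 2 (Fin 2 → ℝ)).comp (measurable_pi_lambda _ fun i => ?_)
  fin_cases i
  · exact measurable_fst
  · exact measurable_snd

instance (h : ℝ≥0) : IsProbabilityMeasure (planeGaussian h) :=
  Measure.isProbabilityMeasure_map measurable_vec.aemeasurable

theorem charFun_planeGaussian (h : ℝ≥0) (t : Plane) :
    charFun (planeGaussian h) t = Complex.exp (-(h * ‖t‖ ^ 2 / 2 : ℝ)) := by
  rw [charFun_apply, planeGaussian, integral_map measurable_vec.aemeasurable
    (by fun_prop)]
  have e : ∀ p : ℝ × ℝ, Complex.exp ((inner ℝ (!₂[p.1, p.2] : Plane) t : ℝ) * Complex.I)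
      = Complex.exp (t 0 * p.1 * Complex.I) * Complex.exp (t 1 * p.2 * Complex.I) := fun p => by
    rw [← Complex.exp_add]
    simp [PiLp.inner_apply, Fin.sum_univ_two]
    ring_nf
  simp only [e]
  rw [integral_prod_mul (fun a : ℝ => Complex.exp (t 0 * a * Complex.I))
    (fun b : ℝ => Complex.exp (t 1 * b * Complex.I)), ← charFun_apply_real, ← charFun_apply_real,
    charFun_gaussianReal, charFun_gaussianReal, ← Complex.exp_add, EuclideanSpace.norm_sq_eq]
  simp [Fin.sum_univ_two]
  ring_nf

theorem norm_charFun_planeGaussian_sq (h : ℝ≥0) (t : Plane) :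
    ‖charFun (planeGaussian h) t‖ ^ 2 = Real.exp (-(h : ℝ) * ‖t‖ ^ 2) := by
  rw [charFun_planeGaussian, Complex.norm_exp, ← Real.exp_nat_mul]
  congr 1
  simp
  norm_cast
  ring

instance (h : ℝ≥0) : (planeGaussian h).IsNegInvariant where
  neg_eq_self := by
    have : IsProbabilityMeasure (planeGaussian h).neg :=
      Measure.isProbabilityMeasure_map measurable_neg.aemeasurable
    refine Measure.ext_of_charFun (funext fun t => ?_)
    have e : charFun (planeGaussian h).neg t = charFun (planeGaussian h) (-t) := by
      rw [charFun_apply, charFun_apply, Measure.neg, integral_map measurable_neg.aemeasurable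
        (by fun_prop)]
      simp
    rw [e, charFun_planeGaussian, charFun_planeGaussian, norm_neg]

theorem map_prod_prod_comm {α α' β β' : Type*} [MeasurableSpace α] [MeasurableSpace α']
    [MeasurableSpace β] [MeasurableSpace β'] (μ : Measure α) (μ' : Measure α') (ν : Measure β)
    (ν' : Measure β') [SFinite μ] [SFinite μ'] [SFinite ν] [SFinite ν'] :
    ((μ.prod ν).prod (μ'.prod ν')).map (fun p => ((p.1.1, p.2.1), (p.1.2, p.2.2)))
      = (μ.prod μ').prod (ν.prod ν') := by
  refine Measure.ext_of_lintegral _ fun f hf => ?_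
  rw [lintegral_map hf (by fun_prop), lintegral_prod _ (by fun_prop), lintegral_prod _ (by fun_prop),
    lintegral_prod _ (by fun_prop), lintegral_prod _ (by fun_prop)]
  refine lintegral_congr fun a => ?_
  have h1 : ∀ c : β, ∫⁻ q : α' × β', f ((a, q.1), (c, q.2)) ∂(μ'.prod ν')
      = ∫⁻ b, ∫⁻ d, f ((a, b), (c, d)) ∂ν' ∂μ' := fun c => lintegral_prod _ (by fun_prop)
  have h2 : ∀ b : α', ∫⁻ q : β × β', f ((a, b), q) ∂(ν.prod ν')
      = ∫⁻ c, ∫⁻ d, f ((a, b), (c, d)) ∂ν' ∂ν := fun b => lintegral_prod _ (by fun_prop)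
  simp only [h1, h2]
  refine lintegral_lintegral_swap (Measurable.aemeasurable ?_)
  exact Measurable.lintegral_prod_right (by fun_prop)

/-! ### Independence of the increments of planar Brownian motion from its past -/

section Indep

variable {Ω : Type*} [MeasurableSpace Ω] {P : Measure Ω}

/-- The joint law of the four variables is the product of their laws, so they can be regrouped. With
`U`, `U'` the pasts and `V`, `V'` the increments of the two coordinates, this turns independence for
each coordinate into independence for the planar motion. -/
theorem IndepFun.prodMk_prodMk_of_indepFun {α α' β β' : Type*} [MeasurableSpace α]
    [MeasurableSpace α'] [MeasurableSpace β] [MeasurableSpace β'] [IsProbabilityMeasure P] {U : Ω → α} {U' : Ω → α'}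
    {V : Ω → β} {V' : Ω → β'} (hU : AEMeasurable U P) (hU' : AEMeasurable U' P)
    (hV : AEMeasurable V P) (hV' : AEMeasurable V' P)
    (h : IndepFun (fun ω => (U ω, V ω)) (fun ω => (U' ω, V' ω)) P) (hUV : IndepFun U V P)
    (hUV' : IndepFun U' V' P) :
    IndepFun (fun ω => (U ω, U' ω)) (fun ω => (V ω, V' ω)) P := by
  have hUU : IndepFun U U' P := h.comp measurable_fst measurable_fst
  have hVV : IndepFun V V' P := h.comp measurable_snd measurable_snd
  have := Measure.isProbabilityMeasure_map hU
  have := Measure.isProbabilityMeasure_map hU'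
  have := Measure.isProbabilityMeasure_map hV
  have := Measure.isProbabilityMeasure_map hV'
  rw [indepFun_iff_map_prod_eq_prod_map_map (hU.prodMk hU') (hV.prodMk hV'),
    (indepFun_iff_map_prod_eq_prod_map_map hU hU').1 hUU,
    (indepFun_iff_map_prod_eq_prod_map_map hV hV').1 hVV, ← map_prod_prod_comm,
    ← (indepFun_iff_map_prod_eq_prod_map_map hU hV).1 hUV,
    ← (indepFun_iff_map_prod_eq_prod_map_map hU' hV').1 hUV',
    ← (indepFun_iff_map_prod_eq_prod_map_map (hU.prodMk hV) (hU'.prodMk hV')).1 h,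
    AEMeasurable.map_map_of_aemeasurable (by fun_prop) ((hU.prodMk hV).prodMk (hU'.prodMk hV'))]
  rfl

variable {B : ℝ≥0 → Ω → Plane} (hB : IsPlanarBrownianMotion B P)
include hB

theorem IsPlanarBrownianMotion.aemeasurable (t : ℝ≥0) : AEMeasurable (B t) P := by
  have : B t = fun ω => (!₂[B t ω 0, B t ω 1] : Plane) := by
    funext ω; ext i; fin_cases i <;> rfl
  rw [this]
  exact measurable_vec.comp_aemeasurable
    (((hB.coord 0).aemeasurable t).prodMk ((hB.coord 1).aemeasurable t))

theorem IsPlanarBrownianMotion.zero : ∀ᵐ ω ∂P, B 0 ω = 0 := by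
  filter_upwards [(hB.coord 0).eval_zero_ae_eq_zero, (hB.coord 1).eval_zero_ae_eq_zero]
    with ω h0 h1
  ext i
  fin_cases i
  · exact h0
  · exact h1

variable [IsProbabilityMeasure P]

theorem IsPlanarBrownianMotion.map_increment (t h : ℝ≥0) :
    P.map (fun ω => B (t + h) ω - B t ω) = planeGaussian h := by
  have hl : ∀ i : Fin 2, P.map (fun ω => B (t + h) ω i - B t ω i) = gaussianReal 0 h := fun i =>
    (((hB.coord i).shift t).hasLaw_eval h).map_eq
  have hm : ∀ i : Fin 2, AEMeasurable (fun ω => B (t + h) ω i - B t ω i) P := fun i =>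
    ((hB.coord i).aemeasurable (t + h)).sub ((hB.coord i).aemeasurable t)
  have hi : IndepFun (fun ω => B (t + h) ω 0 - B t ω 0) (fun ω => B (t + h) ω 1 - B t ω 1) P :=
    hB.indep.comp (φ := fun b : ℝ≥0 → ℝ => b (t + h) - b t)
      (ψ := fun b : ℝ≥0 → ℝ => b (t + h) - b t) (by fun_prop) (by fun_prop)
  have hp := (indepFun_iff_map_prod_eq_prod_map_map (hm 0) (hm 1)).1 hi
  rw [hl 0, hl 1] at hp
  rw [planeGaussian, ← hp, AEMeasurable.map_map_of_aemeasurable measurable_vec.aemeasurable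
    ((hm 0).prodMk (hm 1))]
  congr 1
  funext ω
  ext i
  fin_cases i <;> rfl

theorem IsPlanarBrownianMotion.indepFun_increment {τ : ℕ → ℝ≥0} (t h : ℝ≥0) (hτ : ∀ j, τ j ≤ t) :
    IndepFun (fun ω => ((fun j => B (τ j) ω 0 : ℕ → ℝ), (fun j => B (τ j) ω 1 : ℕ → ℝ)))
      (fun ω => B (t + h) ω - B t ω) P := by
  have hU : ∀ i : Fin 2, AEMeasurable (fun ω => (fun j => B (τ j) ω i : ℕ → ℝ)) P := fun i =>
    aemeasurable_pi_lambda _ fun j => (hB.coord i).aemeasurable (τ j)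
  have hV : ∀ i : Fin 2, AEMeasurable (fun ω => B (t + h) ω i - B t ω i) P := fun i =>
    ((hB.coord i).aemeasurable (t + h)).sub ((hB.coord i).aemeasurable t)
  have hUV : ∀ i : Fin 2, IndepFun (fun ω => (fun j => B (τ j) ω i : ℕ → ℝ))
      (fun ω => B (t + h) ω i - B t ω i) P := fun i =>
    (((hB.coord i).indepFun_shift t).symm.comp
      (φ := fun (b : Set.Iic t → ℝ) (j : ℕ) => b ⟨τ j, hτ j⟩) (ψ := fun b : ℝ≥0 → ℝ => b h)
      (by fun_prop) (by fun_prop))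
  have hall : IndepFun (fun ω => ((fun j => B (τ j) ω 0 : ℕ → ℝ), B (t + h) ω 0 - B t ω 0))
      (fun ω => ((fun j => B (τ j) ω 1 : ℕ → ℝ), B (t + h) ω 1 - B t ω 1)) P :=
    hB.indep.comp (φ := fun b : ℝ≥0 → ℝ => ((fun j => b (τ j) : ℕ → ℝ), b (t + h) - b t))
      (ψ := fun b : ℝ≥0 → ℝ => ((fun j => b (τ j) : ℕ → ℝ), b (t + h) - b t))
      (by fun_prop) (by fun_prop)
  have e : (fun ω => B (t + h) ω - B t ω) = (fun p : ℝ × ℝ => (!₂[p.1, p.2] : Plane)) ∘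
      fun ω => (B (t + h) ω 0 - B t ω 0, B (t + h) ω 1 - B t ω 1) := by
    funext ω
    ext i
    fin_cases i <;> rfl
  rw [e]
  exact (IndepFun.prodMk_prodMk_of_indepFun (hU 0) (hU 1) (hV 0) (hV 1) hall (hUV 0)
    (hUV 1)).comp measurable_id measurable_vec

/-- Markov property: the last increment is independent of the first `k` positions, so integrating it
out replaces `f` by `walkOp f`. -/
theorem IsPlanarBrownianMotion.integral_eulerPath {φ : Plane ≃ᵐ Plane} {κ : ℝ}
    (hφ : DistortsVolumeBy φ κ) (x : Plane) (h : ℝ≥0) {f : Plane → ℝ} (hf : IsTame f) (k : ℕ) :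
    ∫ ω, f (eulerPath φ x (fun j => B (j * h) ω) k) ∂P = (walkOp (planeGaussian h) φ)^[k] f x := by
  induction k generalizing f with
  | zero => simp [eulerPath]
  | succ k ih =>
    have hφm := φ.measurable
    set V : Ω → Plane := fun ω => B (k * h + h) ω - B (k * h) ω with hV
    -- Freezing the index at `k` leaves the first `k` positions unchanged and makes the whole
    -- sequence of times lie in the past of `k h`.
    set τ : ℕ → ℝ≥0 := fun j => (min j k : ℕ) * h with hτ
    set Y : Ω → Plane := fun ω => eulerPath φ x (fun j => B (j * h) ω) k with hY
    have hτk : ∀ j, τ j ≤ k * h := fun j => by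
      simp only [hτ]; gcongr; exact min_le_right _ _
    set G : (ℕ → ℝ) × (ℕ → ℝ) → Plane := fun u =>
      eulerPath φ x (fun j => !₂[u.1 j, u.2 j]) k with hG
    have hGm : Measurable G := measurable_eulerPath hφm x
      (β := fun (u : (ℕ → ℝ) × (ℕ → ℝ)) j => !₂[u.1 j, u.2 j])
      (fun j => measurable_vec.comp (f := fun u : (ℕ → ℝ) × (ℕ → ℝ) => (u.1 j, u.2 j))
        (by fun_prop)) k
    have hYG : Y = fun ω => G ((fun j => B (τ j) ω 0), (fun j => B (τ j) ω 1)) := by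
      funext ω
      refine eulerPath_congr fun j hj => ?_
      simp only [hτ, min_eq_left hj]
      ext i
      fin_cases i <;> rfl
    have hYm : AEMeasurable Y P := by
      rw [hYG]
      exact hGm.comp_aemeasurable (AEMeasurable.prodMk
        (aemeasurable_pi_lambda _ fun j => (hB.coord 0).aemeasurable (τ j))
        (aemeasurable_pi_lambda _ fun j => (hB.coord 1).aemeasurable (τ j)))
    have hVm : AEMeasurable V P := (hB.aemeasurable _).sub (hB.aemeasurable _)
    have hind : IndepFun Y V P := by
      rw [hYG]
      exact (hB.indepFun_increment (k * h) h hτk).comp hGm measurable_id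
    have hlaw := (indepFun_iff_map_prod_eq_prod_map_map hYm hVm).1 hind
    rw [hB.map_increment] at hlaw
    have := Measure.isProbabilityMeasure_map (μ := P) hYm
    have hfm : Measurable fun p : Plane × Plane => f (φ p.1 + p.2) :=
      hf.measurable.comp ((hφm.comp measurable_fst).add measurable_snd)
    obtain ⟨b, hb⟩ := hf.bounded
    have hfi : Integrable (fun p : Plane × Plane => f (φ p.1 + p.2))
        ((P.map Y).prod (planeGaussian h)) :=
      Integrable.of_bound hfm.aestronglyMeasurable b (Eventually.of_forall fun p => by
        rw [Real.norm_of_nonneg (hf.nonneg _)]; exact hb _)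
    have e1 : ∀ ω, eulerPath φ x (fun j => B (j * h) ω) (k + 1) = φ (Y ω) + V ω := fun ω => by
      simp only [eulerPath, hY, hV]
      push_cast
      rw [add_mul, one_mul]
    simp only [e1]
    rw [← integral_map (hYm.prodMk hVm) (f := fun p : Plane × Plane => f (φ p.1 + p.2))
      hfm.aestronglyMeasurable, hlaw, integral_prod _ hfi]
    have hw := hf.walkOp (ν := planeGaussian h) hφ
    rw [Function.iterate_succ_apply, ← ih hw, ← integral_map hYm hw.measurable.aestronglyMeasurable]
    rfl

end Indep

/-! ### The transition probabilities have bounded densities -/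

/-- Compact sets suffice by inner regularity of `κ`; a Urysohn function between a compact set and an
open neighbourhood, with outer regularity of Lebesgue measure, gives the bound there. -/
theorem measure_le_smul_volume_of_integral_le {κ : Measure Plane} [IsFiniteMeasure κ] {M : ℝ}
    (hM : 0 ≤ M) (h : ∀ F : Plane → ℝ, Continuous F → HasCompactSupport F → (∀ x, 0 ≤ F x) →
      ∫ x, F x ∂κ ≤ M * ∫ x, F x) : κ ≤ ENNReal.ofReal M • volume := by
  refine Measure.le_iff.2 fun s hs => ?_
  rw [hs.measure_eq_iSup_isCompact κ]
  refine iSup_le fun K => iSup_le fun hKs => iSup_le fun hK => ?_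
  rw [Measure.smul_apply, smul_eq_mul]
  refine le_trans ?_ (mul_le_mul_right (measure_mono hKs) _)
  have hU : ∀ U, IsOpen U → K ⊆ U → κ K ≤ ENNReal.ofReal M * volume U := by
    intro U hU hKU
    obtain ⟨F, hF1, hF0, hFc, hF⟩ := exists_continuous_one_zero_of_isCompact hK hU.isClosed_compl
      (disjoint_compl_right_iff_subset.2 hKU)
    have hF' : ∀ x, 0 ≤ F x := fun x => (hF x).1
    have hint : Integrable F := F.continuous.integrable_of_hasCompactSupport hFc
    have hintκ : Integrable F κ := F.continuous.integrable_of_hasCompactSupport hFc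
    calc κ K = ∫⁻ x in K, 1 ∂κ := by simp
      _ ≤ ∫⁻ x in K, ENNReal.ofReal (F x) ∂κ := by
        refine setLIntegral_mono' hK.measurableSet fun x hx => ?_
        rw [hF1 hx]; simp
      _ ≤ ∫⁻ x, ENNReal.ofReal (F x) ∂κ := setLIntegral_le_lintegral _ _
      _ = ENNReal.ofReal (∫ x, F x ∂κ) :=
        (ofReal_integral_eq_lintegral_ofReal hintκ (Eventually.of_forall hF')).symm
      _ ≤ ENNReal.ofReal (M * ∫ x, F x) :=
        ENNReal.ofReal_le_ofReal (h F F.continuous hFc hF')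
      _ = ENNReal.ofReal M * ∫⁻ x, ENNReal.ofReal (F x) := by
        rw [ENNReal.ofReal_mul hM,
          ofReal_integral_eq_lintegral_ofReal hint (Eventually.of_forall hF')]
      _ ≤ ENNReal.ofReal M * ∫⁻ x, U.indicator 1 x := by
        gcongr with x
        by_cases hx : x ∈ U
        · rw [indicator_of_mem hx]
          exact ENNReal.ofReal_le_one.2 (hF x).2
        · rw [hF0 hx]; simp
      _ = ENNReal.ofReal M * volume U := by rw [lintegral_indicator_one hU.measurableSet]
  have ht : Tendsto (fun η : ℝ≥0∞ => ENNReal.ofReal M * (volume K + η)) (𝓝[≠] 0)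
      (𝓝 (ENNReal.ofReal M * (volume K + 0))) :=
    (ENNReal.Tendsto.const_mul ((tendsto_const_nhds.add tendsto_id))
      (Or.inr ENNReal.ofReal_ne_top)).mono_left nhdsWithin_le_nhds
  rw [add_zero] at ht
  refine ge_of_tendsto ht ?_
  filter_upwards [self_mem_nhdsWithin] with η hη
  obtain ⟨U, hKU, hUo, hUv⟩ := K.exists_isOpen_le_add volume hη
  exact (hU U hUo hKU).trans (mul_le_mul_right hUv _)

theorem IsTame.of_continuous {F : Plane → ℝ} (hF : Continuous F) (hs : HasCompactSupport F)
    (h0 : ∀ x, 0 ≤ F x) : IsTame F where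
  measurable := hF.measurable
  nonneg := h0
  bounded := by
    obtain ⟨C, hC⟩ := hs.exists_bound_of_continuous hF
    exact ⟨C, fun x => (le_abs_self _).trans (hC x)⟩
  integrable := hF.integrable_of_hasCompactSupport hs

section Flow

variable {Ω : Type*} [MeasurableSpace Ω] {P : Measure Ω} {B : ℝ≥0 → Ω → Plane}
  {H : Plane → ℝ} {ε : ℝ} {X : Plane → ℝ≥0 → Ω → Plane}

section Paths

variable (hB : IsPlanarBrownianMotion B P) (hH : IsGenericHamiltonian H) (hε : 0 < ε)
include hB hH hε

theorem IsFastDiffusion.ae_tendsto_eulerPath {x : Plane} {X : ℝ≥0 → Ω → Plane}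
    (hX : IsFastDiffusion P B H ε x X) (t : ℝ≥0) :
    ∀ᵐ ω ∂P, Tendsto (fun n : ℕ => eulerPath (fun y => y + ((t : ℝ) / n * ε⁻¹) • skewGradient H y) x
      (fun k => B (k * (t / n)) ω) n) atTop (𝓝 (X t ω)) := by
  obtain ⟨K, hK0, hK⟩ := hH.exists_norm_fderiv_fderiv_le
  filter_upwards [hX.continuous, hX.equation, hB.zero] with ω hc heq h0
  have key := tendsto_eulerPath (c := fun y => ε⁻¹ • skewGradient H y) (L := ε⁻¹ * K)
    (by positivity) (fun y z => by
      rw [← smul_sub, norm_smul, Real.norm_of_nonneg (by positivity), mul_assoc]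
      exact mul_le_mul_of_nonneg_left (hH.norm_skewGradient_sub_le hK y z) (by positivity))
    (Z := fun s => X s.toNNReal ω) (w := fun s => B s.toNNReal ω) (x := x)
    (hc.comp continuous_real_toNNReal) (fun s hs => by
      have := heq s.toNNReal
      rwa [Real.coe_toNNReal s hs] at this) (by simpa using h0) (t := t) t.2
  simp only [Real.toNNReal_coe] at key
  refine key.congr fun n => ?_
  congr 1
  · funext y; rw [smul_smul]
  · funext k
    congr 1
    rw [← NNReal.coe_inj, Real.coe_toNNReal _ (by positivity)]
    push_cast
    rfl

/-- The same noise drives both paths, so the Lipschitz bound of the Euler scheme passes to the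
limit. The constant degenerates as `ε → 0`, but it only serves to obtain continuity and
measurability in the starting point. -/
theorem IsFastDiffusion.exists_ae_norm_sub_le
    (hX : ∀ x, IsFastDiffusion P B H ε x (X x)) (t : ℝ≥0) :
    ∃ C : ℝ, ∀ x y, ∀ᵐ ω ∂P, ‖X x t ω - X y t ω‖ ≤ C * ‖x - y‖ := by
  obtain ⟨K, hK0, hK⟩ := hH.exists_norm_fderiv_fderiv_le
  refine ⟨Real.exp (t * (ε⁻¹ * K)), fun x y => ?_⟩
  filter_upwards [(hX x).ae_tendsto_eulerPath hB hH hε t,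
    (hX y).ae_tendsto_eulerPath hB hH hε t] with ω h1 h2
  refine le_of_tendsto (h1.sub h2).norm ?_
  filter_upwards [eventually_gt_atTop 0] with n hn
  have hn0 : (0 : ℝ) < n := by exact_mod_cast hn
  have hr : 0 ≤ (t : ℝ) / n * ε⁻¹ := by positivity
  refine (norm_eulerPath_sub_le (ℓ := 1 + (t : ℝ) / n * (ε⁻¹ * K)) (by positivity) (fun y z => ?_)
    _ x y n).trans ?_
  · calc _ = ‖(y - z) + ((t : ℝ) / n * ε⁻¹) • (skewGradient H y - skewGradient H z)‖ := by
          rw [smul_sub]; congr 1; abel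
      _ ≤ ‖y - z‖ + (t : ℝ) / n * ε⁻¹ * (K * ‖y - z‖) := by
          refine (norm_add_le _ _).trans ?_
          rw [norm_smul, Real.norm_of_nonneg hr]
          gcongr
          exact hH.norm_skewGradient_sub_le hK y z
      _ = _ := by ring
  · gcongr
    calc (1 + (t : ℝ) / n * (ε⁻¹ * K)) ^ n ≤ (Real.exp ((t : ℝ) / n * (ε⁻¹ * K))) ^ n := by
          gcongr; rw [add_comm]; exact Real.add_one_le_exp _
      _ = _ := by rw [← Real.exp_nat_mul]; congr 1; field_simp

variable [IsProbabilityMeasure P]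

theorem continuous_integral_fastDiffusion (hX : ∀ x, IsFastDiffusion P B H ε x (X x)) (t : ℝ≥0)
    {F : Plane → ℝ} (hF : Continuous F) {b : ℝ} (hb : ∀ x, ‖F x‖ ≤ b) :
    Continuous fun x => ∫ ω, F (X x t ω) ∂P := by
  obtain ⟨C, hC⟩ := IsFastDiffusion.exists_ae_norm_sub_le hB hH hε hX t
  -- The exceptional null set depends on the pair of starting points; along a sequence only
  -- countably many occur.
  rw [continuous_iff_seqContinuous]
  intro y x hy
  refine tendsto_integral_of_dominated_convergence (fun _ => b)
    (fun n => (hF.measurable.comp_aemeasurable ((hX (y n)).aemeasurable t)).aestronglyMeasurable)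
    (integrable_const b) (fun n => Eventually.of_forall fun ω => hb _) ?_
  filter_upwards [ae_all_iff.2 fun n => hC (y n) x] with ω hω
  refine (hF.tendsto _).comp (tendsto_iff_norm_sub_tendsto_zero.2 ?_)
  refine squeeze_zero (fun n => norm_nonneg _) hω ?_
  simpa using (tendsto_iff_norm_sub_tendsto_zero.1 hy).const_mul C

/-- Makes the transition probabilities a kernel, which can then be integrated against the weight.
Closed sets generate, and their indicators are limits of continuous functions. -/
theorem measurable_map_fastDiffusion (hX : ∀ x, IsFastDiffusion P B H ε x (X x)) (t : ℝ≥0) :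
    Measurable fun x => P.map (X x t) := by
  have (x : Plane) : IsProbabilityMeasure (P.map (X x t)) :=
    Measure.isProbabilityMeasure_map ((hX x).aemeasurable t)
  refine Measurable.measure_of_isPiSystem_of_isProbabilityMeasure
    (S := {s : Set Plane | IsClosed s}) ?_ isPiSystem_isClosed ?_
  · rw [BorelSpace.measurable_eq (α := Plane), borel_eq_generateFrom_isClosed]
  intro s hs
  have hδ : ∀ n : ℕ, 0 < 1 / ((n : ℝ) + 1) := fun n => by positivity
  refine measurable_of_tendsto_metrizable (f := fun (n : ℕ) x =>
    ∫⁻ y, (thickenedIndicator (hδ n) s y : ℝ≥0∞) ∂(P.map (X x t))) (fun n => ?_) ?_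
  · have hcont := continuous_integral_fastDiffusion hB hH hε hX t
      (F := fun y => (thickenedIndicator (hδ n) s y : ℝ)) (by fun_prop) (b := 1) (fun y => by
        rw [Real.norm_of_nonneg (NNReal.coe_nonneg _)]
        exact_mod_cast thickenedIndicator_le_one (hδ n) s y)
    have e : ∀ x, ∫⁻ y, (thickenedIndicator (hδ n) s y : ℝ≥0∞) ∂(P.map (X x t))
        = ENNReal.ofReal (∫ ω, (thickenedIndicator (hδ n) s (X x t ω) : ℝ) ∂P) := fun x => by
      rw [lintegral_map' (by fun_prop) ((hX x).aemeasurable t), ofReal_integral_eq_lintegral_ofReal]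
      · simp
      · refine Integrable.of_bound (C := 1) ?_ (Eventually.of_forall fun ω => ?_)
        · have hm : Measurable fun y => (thickenedIndicator (hδ n) s y : ℝ) := by fun_prop
          exact (hm.comp_aemeasurable ((hX x).aemeasurable t)).aestronglyMeasurable
        · rw [Real.norm_of_nonneg (NNReal.coe_nonneg _)]
          exact_mod_cast thickenedIndicator_le_one (hδ n) s _
      · exact Eventually.of_forall fun ω => NNReal.coe_nonneg _
    simp only [e]
    exact hcont.measurable.ennreal_ofReal
  · rw [tendsto_pi_nhds]
    intro x
    exact tendsto_lintegral_thickenedIndicator_of_isClosed _ hs hδ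
      tendsto_one_div_add_atTop_nhds_zero_nat

theorem integral_fastDiffusion_mul_le (hX : ∀ x, IsFastDiffusion P B H ε x (X x)) {t : ℝ≥0}
    (ht : 0 < t) {F g : Plane → ℝ} (hF : Continuous F) (hFt : IsTame F) (hF1 : ∫ x, F x ≤ 1)
    (hg : IsTame g) (hg1 : ∫ x, g x ≤ 1) :
    ∫ x, (∫ ω, F (X x t ω) ∂P) * g x ≤ 64 / (Real.pi * t) := by
  obtain ⟨K, hK0, hK⟩ := hH.exists_norm_fderiv_fderiv_le
  obtain ⟨b, hb⟩ := hFt.bounded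
  have hbn : ∀ x, ‖F x‖ ≤ b := fun x => by rw [Real.norm_of_nonneg (hFt.nonneg x)]; exact hb x
  have htr : (0 : ℝ) < t := by exact_mod_cast ht
  set a := (t : ℝ) * ε⁻¹ * K with ha
  have ha0 : 0 ≤ a := by positivity
  -- With `2n` steps `r K = a/(2n)`. Beyond `N` this is at most `1/2`, and `κ^n ≤ exp(a²/n) ≤
  -- e^{1/2} ≤ 2`. Only this threshold depends on `ε`.
  obtain ⟨N, hN⟩ := exists_nat_gt (2 * a + 2 * a ^ 2)
  have hex : ∀ n : ℕ, N < n → ∃ φ : Plane ≃ᵐ Plane, ∃ κ : ℝ, κ ^ n ≤ 2 ∧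
      (∀ x, φ x = x + ((t : ℝ) / (n + n : ℕ) * ε⁻¹) • skewGradient H x) ∧
      DistortsVolumeBy φ κ := by
    intro n hn
    have hn0 : (0 : ℝ) < n := by exact_mod_cast (by omega : 0 < n)
    have hnN : 2 * a + 2 * a ^ 2 < n := hN.trans (by exact_mod_cast hn)
    have hra : (t : ℝ) / (n + n : ℕ) * ε⁻¹ * K = a / (2 * n) := by
      rw [ha]; push_cast; field_simp; ring
    have hrK : (t : ℝ) / (n + n : ℕ) * ε⁻¹ * K ≤ 1 / 2 := by
      rw [hra, div_le_iff₀ (by positivity)]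
      nlinarith [sq_nonneg a]
    obtain ⟨φ, hφ, hd⟩ := hH.exists_eulerMap hK0 hK (r := (t : ℝ) / (n + n : ℕ) * ε⁻¹)
      (by positivity) hrK
    refine ⟨φ, _, ?_, hφ, hd⟩
    rw [hra]
    have e1 : 4 * (a / (2 * n)) ^ 2 = a ^ 2 / n / n := by field_simp; ring
    have e2 : a ^ 2 / n ≤ 1 / 2 := by
      rw [div_le_iff₀ hn0]; nlinarith [sq_nonneg a]
    have e3 : Real.exp (1 / 2) ≤ 2 := by
      have h1 := Real.exp_one_lt_d9
      have h2 : Real.exp (1 / 2) ^ 2 = Real.exp 1 := by rw [← Real.exp_nat_mul]; norm_num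
      nlinarith [Real.exp_pos (1 / 2)]
    calc (1 + 4 * (a / (2 * n)) ^ 2) ^ n ≤ Real.exp (a ^ 2 / n / n) ^ n := by
          rw [e1]; gcongr; rw [add_comm]; exact Real.add_one_le_exp _
      _ = Real.exp (a ^ 2 / n) := by rw [← Real.exp_nat_mul]; congr 1; field_simp
      _ ≤ Real.exp (1 / 2) := Real.exp_le_exp.2 e2
      _ ≤ 2 := e3
  set u : ℕ → Plane → ℝ := fun n x => ∫ ω, F (eulerPath
    (fun y => y + ((t : ℝ) / (n + n : ℕ) * ε⁻¹) • skewGradient H y) x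
      (fun k => B (k * (t / (n + n : ℕ))) ω) (n + n)) ∂P with hu
  have hβm : ∀ (n : ℕ) (x : Plane), AEMeasurable (fun ω => eulerPath
      (fun y => y + ((t : ℝ) / (n + n : ℕ) * ε⁻¹) • skewGradient H y) x
      (fun k => B (k * (t / (n + n : ℕ))) ω) (n + n)) P := fun n x => by
    have hφm : Measurable fun y => y + ((t : ℝ) / (n + n : ℕ) * ε⁻¹) • skewGradient H y := by
      have : Continuous (skewGradient H) :=
        (fun x => (hH.hasFDerivAt_skewGradient x).continuousAt : ∀ x, ContinuousAt _ x)
          |> continuous_iff_continuousAt.2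
      fun_prop
    exact (measurable_eulerPath hφm x (β := fun (b : ℕ → Plane) => b)
      (fun j => measurable_pi_apply j) (n + n)).comp_aemeasurable
        (aemeasurable_pi_lambda _ fun j => hB.aemeasurable _)
  have hstep : ∀ n : ℕ, N < n → AEStronglyMeasurable (u n) volume ∧
      ∫ x, u n x * g x ≤ 64 / (Real.pi * t) := by
    intro n hn
    obtain ⟨φ, κ, hκ, hφ, hd⟩ := hex n hn
    have hφ' : (fun y => y + ((t : ℝ) / (n + n : ℕ) * ε⁻¹) • skewGradient H y) = φ :=
      funext fun y => (hφ y).symm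
    have e : u n = (walkOp (planeGaussian (t / (n + n : ℕ))) φ)^[n + n] F := by
      funext x
      rw [← hB.integral_eulerPath hd x _ hFt, ← hφ']
    have hn0 : 0 < n := by omega
    have hnr : (0 : ℝ) < n := by exact_mod_cast hn0
    rw [e]
    refine ⟨(hFt.walkOp_iterate hd _).measurable.aestronglyMeasurable, ?_⟩
    refine (integral_walkOp_mul_le hd (s := (t / (n + n : ℕ) : ℝ≥0)) (by positivity)
      (fun z => by rw [norm_charFun_planeGaussian_sq]) hFt hg hF1 hg1 hn0 hκ).trans_eq ?_
    congr 2
    push_cast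
    field_simp
  have hlim : ∀ x, Tendsto (fun n => u n x) atTop (𝓝 (∫ ω, F (X x t ω) ∂P)) := by
    intro x
    have hdouble : Tendsto (fun n : ℕ => n + n) atTop atTop :=
      tendsto_atTop_mono (fun n => Nat.le_add_right n n) tendsto_id
    refine tendsto_integral_of_dominated_convergence (fun _ => b)
      (fun n => (hF.measurable.comp_aemeasurable (hβm n x)).aestronglyMeasurable)
      (integrable_const b) (fun n => Eventually.of_forall fun ω => hbn _) ?_
    filter_upwards [(hX x).ae_tendsto_eulerPath hB hH hε t] with ω hω
    exact (hF.tendsto _).comp (hω.comp hdouble)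
  have hub : ∀ n x, ‖u n x‖ ≤ b := fun n x => by
    refine (norm_integral_le_of_norm_le_const (Eventually.of_forall fun ω => hbn _)).trans ?_
    simp
  have hT : Tendsto (fun n => ∫ x, u n x * g x) atTop (𝓝 (∫ x, (∫ ω, F (X x t ω) ∂P) * g x)) := by
    refine tendsto_integral_filter_of_dominated_convergence (fun x => b * g x) ?_ ?_
      (hg.integrable.const_mul b) (Eventually.of_forall fun x => (hlim x).mul_const _)
    · filter_upwards [eventually_gt_atTop N] with n hn
      exact (hstep n hn).1.mul hg.measurable.aestronglyMeasurable
    · refine Eventually.of_forall fun n => Eventually.of_forall fun x => ?_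
      rw [norm_mul, Real.norm_of_nonneg (hg.nonneg x)]
      exact mul_le_mul_of_nonneg_right (hub n x) (hg.nonneg x)
  refine le_of_tendsto hT ?_
  filter_upwards [eventually_gt_atTop N] with n hn
  exact (hstep n hn).2

/-- By continuity in the starting point, a violation at `x` persists on a small ball; the normalised
indicator of that ball contradicts the averaged bound. -/
theorem integral_fastDiffusion_le_of_integral_le_one (hX : ∀ x, IsFastDiffusion P B H ε x (X x))
    {t : ℝ≥0} (ht : 0 < t) {F : Plane → ℝ} (hF : Continuous F) (hFt : IsTame F)
    (hF1 : ∫ x, F x ≤ 1) (x : Plane) : ∫ ω, F (X x t ω) ∂P ≤ 64 / (Real.pi * t) := by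
  obtain ⟨b, hb⟩ := hFt.bounded
  have hbn : ∀ x, ‖F x‖ ≤ b := fun x => by rw [Real.norm_of_nonneg (hFt.nonneg x)]; exact hb x
  have hc := continuous_integral_fastDiffusion hB hH hε hX t hF hbn
  set S := fun x => ∫ ω, F (X x t ω) ∂P with hS
  by_contra! hlt
  obtain ⟨M', hM1, hM2⟩ := exists_between hlt
  obtain ⟨ρ, hρ, hball⟩ := Metric.isOpen_iff.1 (isOpen_lt continuous_const hc) x hM2
  have hv0 : 0 < volume (Metric.ball x ρ) := Metric.measure_ball_pos _ _ hρ
  have hvt : volume (Metric.ball x ρ) ≠ ∞ := measure_ball_lt_top.ne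
  set v := (volume : Measure Plane).real (Metric.ball x ρ) with hv
  have hvpos : 0 < v := ENNReal.toReal_pos hv0.ne' hvt
  have hconst : IntegrableOn (fun _ : Plane => v⁻¹) (Metric.ball x ρ) := integrableOn_const hvt
  have hg : IsTame ((Metric.ball x ρ).indicator fun _ => v⁻¹) :=
    { measurable := measurable_const.indicator measurableSet_ball
      nonneg := fun y => indicator_nonneg (fun _ _ => by positivity) y
      bounded := ⟨v⁻¹, fun y => indicator_le_self' (fun _ _ => by positivity) y⟩
      integrable := (integrable_indicator_iff measurableSet_ball).2 hconst }
  have hg1 : ∫ y, (Metric.ball x ρ).indicator (fun _ => v⁻¹) y = 1 := by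
    rw [integral_indicator measurableSet_ball, setIntegral_const, smul_eq_mul, ← hv]
    exact mul_inv_cancel₀ hvpos.ne'
  have key := integral_fastDiffusion_mul_le hB hH hε hX ht hF hFt hF1 hg hg1.le
  have h2 : M' ≤ ∫ y, S y * (Metric.ball x ρ).indicator (fun _ => v⁻¹) y := by
    calc M' = ∫ y, M' * (Metric.ball x ρ).indicator (fun _ => v⁻¹) y := by
          rw [integral_const_mul, hg1, mul_one]
      _ ≤ _ := by
        refine integral_mono (hg.integrable.const_mul M') ?_ fun y => ?_
        · refine hg.integrable.bdd_mul (c := b) hc.aestronglyMeasurable (Eventually.of_forall fun y => ?_)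
          refine (norm_integral_le_of_norm_le_const (Eventually.of_forall fun ω => hbn _)).trans ?_
          simp
        · dsimp only
          by_cases hy : y ∈ Metric.ball x ρ
          · exact mul_le_mul_of_nonneg_right (le_of_lt (hball hy)) (hg.nonneg y)
          · simp [indicator_of_notMem hy]
  linarith

/-- The transition probabilities have densities bounded by `64 / (π t)`, uniformly in `ε`. -/
theorem map_fastDiffusion_le (hX : ∀ x, IsFastDiffusion P B H ε x (X x)) {t : ℝ≥0} (ht : 0 < t)
    (x : Plane) : P.map (X x t) ≤ ENNReal.ofReal (64 / (Real.pi * t)) • volume := by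
  have : IsProbabilityMeasure (P.map (X x t)) :=
    Measure.isProbabilityMeasure_map ((hX x).aemeasurable t)
  have hpi := Real.pi_pos
  refine measure_le_smul_volume_of_integral_le (by positivity) fun F hF hFs hF0 => ?_
  have hFt := IsTame.of_continuous hF hFs hF0
  rw [integral_map ((hX x).aemeasurable t) hF.aestronglyMeasurable]
  have hI0 : 0 ≤ ∫ x, F x := integral_nonneg hF0
  -- A strictly larger `d` keeps the normalising constant `c` positive even when `∫ F = 0`.
  refine le_of_forall_gt_imp_ge_of_dense fun d hd => ?_
  have hM : 0 < 64 / (Real.pi * t) := by positivity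
  set c := d / (64 / (Real.pi * t)) with hc
  have hcF : ∫ x, F x < c := by rw [hc, lt_div_iff₀ hM, mul_comm]; exact hd
  have hc0 : 0 < c := hI0.trans_lt hcF
  have hFt' : IsTame fun y => c⁻¹ * F y :=
    IsTame.of_continuous (by fun_prop) hFs.mul_left fun y => mul_nonneg (by positivity) (hF0 y)
  have key := integral_fastDiffusion_le_of_integral_le_one hB hH hε hX ht (by fun_prop) hFt' (by
    rw [integral_const_mul, inv_mul_le_iff₀ hc0, mul_one]; exact hcF.le) x
  rw [integral_const_mul, inv_mul_le_iff₀ hc0, hc, div_mul_cancel₀ _ hM.ne'] at key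
  exact key

end Paths

end Flow

/-! ### The elements of the reproducing kernel space are functions -/

section Spectral

variable (μ : Measure Plane) [μ.HasTemperateGrowth]

/-- The class in `L²(μ)` of the Fourier transform of a Schwartz function. -/
noncomputable def spectralMap : QSchwartz μ →ₗ[ℝ] Lp ℂ 2 μ where
  toFun φ := ((realFourier φ).memLp 2 μ).toLp (realFourier φ)
  map_add' φ ψ := by
    rw [← MemLp.toLp_add]
    refine MemLp.toLp_congr _ _ (Eventually.of_forall fun ξ => ?_)
    exact congrArg (fun f : 𝓢(Plane, ℂ) => f ξ) (realFourier_add φ ψ)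
  map_smul' r φ := by
    rw [RingHom.id_apply, ← MemLp.toLp_const_smul]
    refine MemLp.toLp_congr _ _ (Eventually.of_forall fun ξ => ?_)
    exact congrArg (fun f : 𝓢(Plane, ℂ) => f ξ) (realFourier_smul r φ)

theorem norm_spectralMap (φ : QSchwartz μ) : ‖spectralMap μ φ‖ = ‖φ‖ := by
  have h1 : ‖φ‖ ^ 2 = spectralForm μ φ φ := by
    rw [← real_inner_self_eq_norm_sq]; rfl
  have h2 : ‖spectralMap μ φ‖ ^ 2 = spectralForm μ φ φ := by
    refine (integral_norm_sq_eq_norm_toLp ((realFourier φ).memLp 2 μ)).symm.trans ?_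
    refine integral_congr_ae (Eventually.of_forall fun ξ => ?_)
    dsimp only
    rw [Complex.mul_conj, Complex.normSq_eq_norm_sq, Complex.ofReal_re]
  exact (pow_left_inj₀ (norm_nonneg _) (norm_nonneg _) two_ne_zero).1 (h2.trans h1.symm)

/-- The isometric embedding of `𝒮_q` into `L²(μ)` by the Fourier transform. -/
noncomputable def spectralIsometry : QCompletion μ →ₗᵢ[ℝ] Lp ℂ 2 μ where
  toLinearMap := (ContinuousLinearMap.extend
    ((⟨spectralMap μ, norm_spectralMap μ⟩ : QSchwartz μ →ₗᵢ[ℝ] Lp ℂ 2 μ).toContinuousLinearMap)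
    (UniformSpace.Completion.toComplL : QSchwartz μ →L[ℝ] QCompletion μ)).toLinearMap
  norm_map' v := by
    induction v using UniformSpace.Completion.induction_on with
    | hp => exact isClosed_eq (by fun_prop) (by fun_prop)
    | ih φ =>
      have := ContinuousLinearMap.extend_eq
        ((⟨spectralMap μ, norm_spectralMap μ⟩ : QSchwartz μ →ₗᵢ[ℝ] Lp ℂ 2 μ).toContinuousLinearMap)
        (e := (UniformSpace.Completion.toComplL : QSchwartz μ →L[ℝ] QCompletion μ))
        (UniformSpace.Completion.denseRange_coe)
        (UniformSpace.Completion.isUniformInducing_coe _) φ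
      refine (congrArg norm this).trans ?_
      rw [UniformSpace.Completion.norm_coe]
      exact norm_spectralMap μ φ

theorem spectralIsometry_qClass (φ : 𝓢(Plane, ℝ)) :
    spectralIsometry μ (qClass μ φ) = ((realFourier φ).memLp 2 μ).toLp (realFourier φ) :=
  ContinuousLinearMap.extend_eq
    ((⟨spectralMap μ, norm_spectralMap μ⟩ : QSchwartz μ →ₗᵢ[ℝ] Lp ℂ 2 μ).toContinuousLinearMap)
    (e := (UniformSpace.Completion.toComplL : QSchwartz μ →L[ℝ] QCompletion μ))
    (UniformSpace.Completion.denseRange_coe)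
    (UniformSpace.Completion.isUniformInducing_coe _) φ

/-- The spectral density in `L²(μ)` of an element of `𝒮_q'`. -/
noncomputable def spectralDensity : QDual μ →ₗᵢ[ℝ] Lp ℂ 2 μ :=
  (spectralIsometry μ).comp
    (InnerProductSpace.toDual ℝ (QCompletion μ)).symm.toLinearIsometry

/-- The Riesz representative of `ξ`, carried to `L²(μ)`, acts as the density of the Fourier
transform of `ξ` with respect to `μ`. -/
theorem apply_qClass_eq_integral (ξ : QDual μ) (φ : 𝓢(Plane, ℝ)) :
    ξ (qClass μ φ) = ∫ k, (conj (realFourier φ k) * spectralDensity μ ξ k).re ∂μ := by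
  have h1 : ξ (qClass μ φ)
      = inner ℝ ((InnerProductSpace.toDual ℝ (QCompletion μ)).symm ξ) (qClass μ φ) := by
    rw [InnerProductSpace.toDual_symm_apply]
  rw [h1, ← (spectralIsometry μ).inner_map_map, spectralIsometry_qClass, L2.inner_def]
  refine integral_congr_ae ?_
  filter_upwards [((realFourier φ).memLp 2 μ).coeFn_toLp] with k hk
  rw [hk]
  rw [Complex.inner]
  simp only [Complex.mul_re, Complex.conj_re, Complex.conj_im]
  change (realFourier φ k).re * (spectralDensity μ ξ k).re
    - (realFourier φ k).im * -(spectralDensity μ ξ k).im = _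
  ring

end Spectral

/-! ### Spectral measures with a density in `L^p` -/

section Density

variable {m : Plane → ℝ} (hm : Measurable m) (h0 : ∀ x, 0 ≤ m x) {p : ℝ} (hp : 1 < p)
  (hmp : MemLp m (ENNReal.ofReal p) volume)

include h0 hp hmp

theorem integrable_rpow_of_memLp : Integrable fun x => m x ^ p := by
  have h := hmp.integrable_norm_rpow (by simp; linarith) (by simp)
  rw [ENNReal.toReal_ofReal (by linarith)] at h
  refine h.congr (Eventually.of_forall fun x => ?_)
  simp [abs_of_nonneg (h0 x)]

theorem eLpNorm_toReal_rpow :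
    (eLpNorm m (ENNReal.ofReal p) volume).toReal ^ p = ∫ x, m x ^ p := by
  have hp0 : 0 < p := by linarith
  rw [hmp.eLpNorm_eq_integral_rpow_norm (by simpa using hp0) (by simp),
    ENNReal.toReal_ofReal (by positivity), ENNReal.toReal_ofReal hp0.le,
    ← Real.rpow_mul (integral_nonneg fun x => by positivity), inv_mul_cancel₀ hp0.ne', Real.rpow_one]
  refine integral_congr_ae (Eventually.of_forall fun x => ?_)
  simp [abs_of_nonneg (h0 x)]

omit hmp in
theorem indicator_lt_le_rpow {l : ℝ} (hl : 0 < l) (x : Plane) :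
    {x | l < m x}.indicator m x ≤ l ^ (1 - p) * m x ^ p := by
  by_cases hx : x ∈ {x | l < m x}
  · rw [indicator_of_mem hx]
    have hx' : l < m x := hx
    have hmx : 0 < m x := hl.trans hx'
    calc m x = m x ^ (1 - p) * m x ^ p := by rw [← Real.rpow_add hmx]; simp
      _ ≤ l ^ (1 - p) * m x ^ p := by
        refine mul_le_mul_of_nonneg_right ?_ (Real.rpow_nonneg hmx.le _)
        exact Real.rpow_le_rpow_of_nonpos hl hx'.le (by linarith)
  · rw [indicator_of_notMem hx]
    have := h0 x
    positivity

include hm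

theorem integrable_indicator_lt {l : ℝ} (hl : 0 < l) : Integrable ({x | l < m x}.indicator m) := by
  refine ((integrable_rpow_of_memLp h0 hp hmp).const_mul (l ^ (1 - p))).mono'
    (hm.indicator (measurableSet_lt measurable_const hm)).aestronglyMeasurable
    (Eventually.of_forall fun x => ?_)
  rw [Real.norm_of_nonneg (indicator_nonneg (fun x _ => h0 x) x)]
  exact indicator_lt_le_rpow h0 hp hl x

/-- The part of `m` below `l` is handled by Plancherel. Above `l` one has `m ≤ l^{1-p} m^p`, which
is integrable, and `|𝓕h| ≤ ‖h‖₁`. -/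
theorem memLp_fourier_withDensity {h : Plane → ℂ} (h1 : Integrable h) (h2 : MemLp h 2) {l : ℝ}
    (hl : 0 < l) :
    MemLp (𝓕 h) 2 (volume.withDensity fun x => ENNReal.ofReal (m x)) ∧
    ∫ ξ, ‖𝓕 h ξ‖ ^ 2 ∂(volume.withDensity fun x => ENNReal.ofReal (m x))
      ≤ l * (∫ x, ‖h x‖ ^ 2) + l ^ (1 - p) * (∫ x, m x ^ p) * (∫ x, ‖h x‖) ^ 2 := by
  have hc : Continuous (𝓕 h) :=
    VectorFourier.fourierIntegral_continuous Real.continuous_fourierChar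
      (by exact continuous_inner) h1
  have hF2 : Integrable fun ξ => ‖𝓕 h ξ‖ ^ 2 := (memLp_fourier h1 h2).integrable_norm_pow (by norm_num)
  set A := ∫ x, ‖h x‖ with hA
  have hmpi := integrable_rpow_of_memLp h0 hp hmp
  have hpt : ∀ ξ, m ξ * ‖𝓕 h ξ‖ ^ 2 ≤ l * ‖𝓕 h ξ‖ ^ 2 + l ^ (1 - p) * m ξ ^ p * A ^ 2 := by
    intro ξ
    have hle : m ξ ≤ l + {x | l < m x}.indicator m ξ := by
      by_cases hx : ξ ∈ {x | l < m x}
      · rw [indicator_of_mem hx]; linarith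
      · rw [indicator_of_notMem hx]; simpa using hx
    have hi0 : 0 ≤ {x | l < m x}.indicator m ξ := indicator_nonneg (fun x _ => h0 x) ξ
    calc m ξ * ‖𝓕 h ξ‖ ^ 2 ≤ (l + {x | l < m x}.indicator m ξ) * ‖𝓕 h ξ‖ ^ 2 := by gcongr
      _ = l * ‖𝓕 h ξ‖ ^ 2 + {x | l < m x}.indicator m ξ * ‖𝓕 h ξ‖ ^ 2 := by ring
      _ ≤ l * ‖𝓕 h ξ‖ ^ 2 + {x | l < m x}.indicator m ξ * A ^ 2 := by
        gcongr; exact norm_fourier_le ξ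
      _ ≤ _ := by gcongr; exact indicator_lt_le_rpow h0 hp hl ξ
  have hbi : Integrable fun ξ => l * ‖𝓕 h ξ‖ ^ 2 + l ^ (1 - p) * m ξ ^ p * A ^ 2 :=
    (hF2.const_mul l).add ((hmpi.const_mul _).mul_const _)
  have hmi : Integrable fun ξ => m ξ * ‖𝓕 h ξ‖ ^ 2 := by
    refine hbi.mono' (hm.aestronglyMeasurable.mul (hc.norm.pow 2).aestronglyMeasurable)
      (Eventually.of_forall fun ξ => ?_)
    rw [Real.norm_of_nonneg (mul_nonneg (h0 ξ) (by positivity))]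
    exact hpt ξ
  constructor
  · rw [memLp_two_iff_integrable_sq_norm hc.aestronglyMeasurable,
      integrable_withDensity_iff_integrable_smul' hm.ennreal_ofReal (by simp)]
    refine hmi.congr (Eventually.of_forall fun ξ => ?_)
    simp [ENNReal.toReal_ofReal (h0 ξ)]
  · rw [integral_withDensity_eq_integral_toReal_smul hm.ennreal_ofReal (by simp)]
    simp only [ENNReal.toReal_ofReal (h0 _), smul_eq_mul]
    refine (integral_mono hmi hbi hpt).trans_eq ?_
    rw [integral_add (hF2.const_mul l) ((hmpi.const_mul _).mul_const _), integral_const_mul,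
      integral_mul_const, integral_const_mul, integral_norm_sq_fourier h1 h2]

/-- The Fourier multiplier estimate obtained by cutting the density at the optimal level. -/
theorem integral_norm_fourier_sq_le {h : Plane → ℂ} (h1 : Integrable h) (h2 : MemLp h 2)
    {M D : ℝ} (hM : 0 < M) (hD1 : (∫ x, ‖h x‖) ^ 2 ≤ D) (hD2 : ∫ x, ‖h x‖ ^ 2 ≤ M * D) :
    ∫ ξ, ‖𝓕 h ξ‖ ^ 2 ∂(volume.withDensity fun x => ENNReal.ofReal (m x))
      ≤ 2 * (eLpNorm m (ENNReal.ofReal p) volume).toReal * M ^ ((p - 1) / p) * D := by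
  have hp0 : 0 < p := by linarith
  have hI := eLpNorm_toReal_rpow h0 hp hmp
  set N := (eLpNorm m (ENNReal.ofReal p) volume).toReal with hN
  have hN0 : 0 ≤ N := ENNReal.toReal_nonneg
  -- The cutting level is proportional to `N` and must be positive; for `N = 0` the spectral measure
  -- vanishes.
  rcases hN0.eq_or_lt with hz | hpos
  · have hn : eLpNorm m (ENNReal.ofReal p) volume = 0 :=
      ((ENNReal.toReal_eq_zero_iff _).1 (hN ▸ hz.symm)).resolve_right hmp.2.ne
    have hm0 := (eLpNorm_eq_zero_iff hmp.1 (by simpa using hp0)).1 hn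
    have : (volume.withDensity fun x => ENNReal.ofReal (m x)) = 0 := by
      rw [withDensity_eq_zero_iff hm.ennreal_ofReal.aemeasurable]
      filter_upwards [hm0] with x hx
      simp [hx]
    rw [this, ← hz]
    simp
  -- This level balances the two terms: `l M` and `l^{1-p} N^p` both equal `N M^{(p-1)/p}`, whence
  -- the factor `2`.
  · set l := N * M ^ (-(1 / p)) with hl
    have hl0 : 0 < l := by positivity
    have key := (memLp_fourier_withDensity hm h0 hp hmp h1 h2 hl0).2
    rw [← hI] at key
    have e0 : M ^ (-(1 / p)) * M = M ^ ((p - 1) / p) := by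
      nth_rewrite 2 [← Real.rpow_one M]
      rw [← Real.rpow_add hM]
      congr 1
      field_simp
      ring
    have e1 : l * M = N * M ^ ((p - 1) / p) := by rw [hl, mul_assoc, e0]
    have e2 : l ^ (1 - p) * N ^ p = N * M ^ ((p - 1) / p) := by
      rw [hl, Real.mul_rpow hN0 (by positivity), ← Real.rpow_mul hM.le]
      have e3 : -(1 / p) * (1 - p) = (p - 1) / p := by field_simp; ring
      have e4 : N ^ (1 - p) * N ^ p = N := by rw [← Real.rpow_add hpos]; simp
      rw [e3]
      linear_combination M ^ ((p - 1) / p) * e4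
    calc _ ≤ _ := key
      _ ≤ l * (M * D) + l ^ (1 - p) * N ^ p * D := by gcongr
      _ = _ := by rw [← mul_assoc, e1, e2]; ring

/-- The function with spectral density `F`. -/
theorem exists_function_of_spectralDensity
    (F : Lp ℂ 2 (volume.withDensity fun x => ENNReal.ofReal (m x))) :
    ∃ f : Plane → ℝ, Measurable f ∧ LocallyIntegrable f volume ∧
      ∀ h : Plane → ℝ, Integrable h → MemLp h 2 →
        Integrable (fun x => f x * h x) ∧
        ∫ x, f x * h x = ∫ k, (conj (𝓕 (fun x => (h x : ℂ)) k) * F k).re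
          ∂(volume.withDensity fun x => ENNReal.ofReal (m x)) := by
  -- `F m` is split because it need not lie in a single convenient space. On `S` it is in `L¹`,
  -- since `m|F| ≤ m|F|² + m`; off `S` it is in `L²`, since `m²|F|² ≤ m|F|²`.
  set S := {x | 1 < m x} with hS
  have hSm : MeasurableSet S := measurableSet_lt measurable_const hm
  have hFm : Measurable F := (Lp.stronglyMeasurable F).measurable
  have hF2 : Integrable fun x => m x * ‖F x‖ ^ 2 := by
    have := (Lp.memLp F).integrable_norm_pow (by norm_num)
    rw [integrable_withDensity_iff_integrable_smul' hm.ennreal_ofReal (by simp)] at this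
    refine this.congr (Eventually.of_forall fun ξ => ?_)
    simp [ENNReal.toReal_ofReal (h0 ξ)]
  have hgm : Measurable fun x => F x * (m x : ℂ) := hFm.mul (Complex.measurable_ofReal.comp hm)
  set g1 : Plane → ℂ := S.indicator fun x => F x * (m x : ℂ) with hg1
  set g2 : Plane → ℂ := Sᶜ.indicator fun x => F x * (m x : ℂ) with hg2
  have hg1i : Integrable g1 := by
    refine (hF2.add (integrable_indicator_lt hm h0 hp hmp one_pos)).mono'
      (hgm.indicator hSm).aestronglyMeasurable (Eventually.of_forall fun x => ?_)
    have hmx := h0 x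
    by_cases hx : x ∈ S
    · simp only [hg1, Pi.add_apply]
      rw [indicator_of_mem hx, indicator_of_mem hx, norm_mul, Complex.norm_real,
        Real.norm_of_nonneg hmx]
      nlinarith [mul_nonneg hmx (sq_nonneg (‖F x‖ - 1)), mul_nonneg hmx (norm_nonneg (F x))]
    · simp only [hg1, Pi.add_apply]
      rw [indicator_of_notMem hx, norm_zero]
      exact add_nonneg (by positivity) (indicator_nonneg (fun x _ => h0 x) x)
  have hg2i : MemLp g2 2 := by
    rw [memLp_two_iff_integrable_sq_norm (hgm.indicator hSm.compl).aestronglyMeasurable]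
    refine hF2.mono' ((hgm.indicator hSm.compl).norm.pow_const 2).aestronglyMeasurable
      (Eventually.of_forall fun x => ?_)
    have hmx := h0 x
    by_cases hx : x ∈ Sᶜ
    · have : m x ≤ 1 := by simpa [hS] using hx
      rw [indicator_of_mem hx, norm_mul, Complex.norm_real, Real.norm_of_nonneg hmx,
        Real.norm_of_nonneg (by positivity), mul_pow, mul_comm]
      gcongr
      nlinarith
    · rw [indicator_of_notMem hx]
      simp
      positivity
  set f1 : Plane → ℂ := 𝓕⁻ g1 with hf1
  set f2 : Lp ℂ 2 (volume : Measure Plane) := 𝓕⁻ (hg2i.toLp g2) with hf2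
  have hf1c : Continuous f1 := by
    have : f1 = fun x => 𝓕 g1 (-x) := funext fun x => Real.fourierInv_eq_fourier_neg g1 x
    rw [this]
    exact (VectorFourier.fourierIntegral_continuous Real.continuous_fourierChar
      (by exact continuous_inner) hg1i).comp continuous_neg
  have hf1b : ∀ x, ‖f1 x‖ ≤ ∫ y, ‖g1 y‖ := fun x => by
    rw [hf1, Real.fourierInv_eq_fourier_neg]; exact norm_fourier_le _
  have hf2m : Measurable f2 := (Lp.stronglyMeasurable f2).measurable
  -- Real test functions see only the real part, so no Hermitian symmetry of `F` is needed.
  refine ⟨fun x => (f1 x + f2 x).re, Complex.measurable_re.comp (hf1c.measurable.add hf2m), ?_, ?_⟩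
  · have : LocallyIntegrable (fun x => f1 x + f2 x) :=
      hf1c.locallyIntegrable.add ((Lp.memLp f2).locallyIntegrable (by norm_num))
    intro x
    obtain ⟨U, hU, hi⟩ := this x
    exact ⟨U, hU, hi.re⟩
  -- Schwartz tests would not be enough: the pairing is applied later to a transition density times
  -- `ψ`.
  intro h h1 h2
  have i1 : Integrable fun x => conj (h x : ℂ) * f1 x := by
    have := h1.ofReal (𝕜 := ℂ)
    simp only [Complex.conj_ofReal]
    exact this.mul_bdd (c := ∫ y, ‖g1 y‖) hf1c.aestronglyMeasurable (Eventually.of_forall hf1b)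
  have hh2 : MemLp (fun x => (h x : ℂ)) 2 := h2.ofReal
  have hh1 : Integrable fun x => (h x : ℂ) := h1.ofReal
  have i2 : Integrable fun x => conj (h x : ℂ) * f2 x := by
    simp only [Complex.conj_ofReal]
    exact hh2.integrable_mul (Lp.memLp f2)
  have e1 : ∫ x, conj (h x : ℂ) * f1 x = ∫ k, conj (𝓕 (fun x => (h x : ℂ)) k) * g1 k :=
    (integral_conj_fourier_mul hh1 hg1i).symm
  have e2 : ∫ x, conj (h x : ℂ) * f2 x = ∫ k, conj (𝓕 (fun x => (h x : ℂ)) k) * g2 k := by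
    have a1 := Lp.inner_fourier_eq (hh2.toLp _) f2
    rw [hf2, FourierTransform.fourier_fourierInv_eq, ← toLp_fourier_eq hh1 hh2, L2.inner_def,
      L2.inner_def] at a1
    refine Eq.trans (integral_congr_ae ?_) (a1.symm.trans (integral_congr_ae ?_))
    · filter_upwards [hh2.coeFn_toLp] with x hx
      rw [hx]
      simp [hf2, mul_comm]
    · filter_upwards [(memLp_fourier hh1 hh2).coeFn_toLp, hg2i.coeFn_toLp] with x hx hx'
      rw [hx, hx']
      simp [mul_comm]
  have hhc : Continuous (𝓕 (fun x => (h x : ℂ))) :=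
    VectorFourier.fourierIntegral_continuous Real.continuous_fourierChar
      (by exact continuous_inner) hh1
  have hhs : AEStronglyMeasurable (fun k => conj (𝓕 (fun x => (h x : ℂ)) k)) volume :=
    (Complex.continuous_conj.comp hhc).aestronglyMeasurable
  have j1 : Integrable fun k => conj (𝓕 (fun x => (h x : ℂ)) k) * g1 k :=
    hg1i.bdd_mul (c := ∫ x, ‖(h x : ℂ)‖) hhs (Eventually.of_forall fun k => by
      rw [RCLike.norm_conj]; exact norm_fourier_le k)
  have j2 : Integrable fun k => conj (𝓕 (fun x => (h x : ℂ)) k) * g2 k :=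
    (memLp_fourier hh1 hh2).star.integrable_mul hg2i
  have hsum : ∀ k, g1 k + g2 k = F k * (m k : ℂ) := fun k =>
    congrFun (indicator_self_add_compl S fun x => F x * (m x : ℂ)) k
  have hre : ∀ x, (f1 x + f2 x).re * h x = (conj (h x : ℂ) * f1 x + conj (h x : ℂ) * f2 x).re :=
    fun x => by simp; ring
  simp only [hre]
  refine ⟨(i1.add i2).re, ?_⟩
  rw [integral_withDensity_eq_integral_toReal_smul hm.ennreal_ofReal (by simp)]
  have k1 : ∫ x, (conj (h x : ℂ) * f1 x + conj (h x : ℂ) * f2 x)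
      = ∫ k, (conj (𝓕 (fun x => (h x : ℂ)) k) * g1 k + conj (𝓕 (fun x => (h x : ℂ)) k) * g2 k) := by
    rw [integral_add i1 i2, integral_add j1 j2, e1, e2]
  have k2 := congrArg Complex.re k1
  have r1 := integral_re (i1.add i2)
  have r2 := integral_re (j1.add j2)
  simp only [RCLike.re_to_complex, Pi.add_apply] at r1 r2
  rw [← r1, ← r2] at k2
  refine k2.trans (integral_congr_ae (Eventually.of_forall fun k => ?_))
  dsimp only
  rw [← mul_add, hsum, ENNReal.toReal_ofReal (h0 k), smul_eq_mul, ← mul_assoc,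
    Complex.re_mul_ofReal, mul_comm]

end Density

/-! ### Hilbert–Schmidt operators given by pointwise evaluations -/

theorem eLpNorm_two_sq {α E : Type*} [MeasurableSpace α] {W : Measure α} [NormedAddCommGroup E]
    (f : α → E) : eLpNorm f 2 W ^ 2 = ∫⁻ x, ‖f x‖ₑ ^ 2 ∂W := by
  have h := eLpNorm_nnreal_pow_eq_lintegral (μ := W) (f := f) (p := 2) two_ne_zero
  simpa using h

/-- For almost every `x` evaluation at `x` is a bounded functional with representative `v`, and
Bessel's inequality for the orthonormal family `J (b i)` bounds the sum of squares at `x` by `‖v‖²`.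
Integration over `x` gives the Hilbert–Schmidt norm. Only the majorant `k` is integrated, so `v`
need not depend measurably on `x`. -/
theorem exists_operator_of_pointwise {α E L : Type*} [MeasurableSpace α] {W : Measure α}
    [NormedAddCommGroup E] [InnerProductSpace ℝ E] [NormedAddCommGroup L] [InnerProductSpace ℝ L]
    (J : E →ₗᵢ[ℝ] L) (a : E → α → ℝ) (ham : ∀ ξ, StronglyMeasurable (a ξ)) (k : α → ℝ≥0∞)
    (ha : ∀ᵐ x ∂W, ∃ v : L, ‖v‖ₑ ^ 2 ≤ k x ∧ ∀ ξ, a ξ x = inner ℝ v (J ξ))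
    (hk : ∫⁻ x, k x ∂W ≠ ∞) :
    ∃ A : E →L[ℝ] Lp ℝ 2 W, (∀ ξ, A ξ =ᵐ[W] a ξ) ∧ hilbertSchmidtSq A ≤ ∫⁻ x, k x ∂W := by
  set R := ∫⁻ x, k x ∂W with hR
  have hsq : ∀ ξ, eLpNorm (a ξ) 2 W ^ 2 ≤ ‖ξ‖ₑ ^ 2 * R := by
    intro ξ
    rw [eLpNorm_two_sq, hR, ← lintegral_const_mul' _ _ (by simp)]
    refine lintegral_mono_ae ?_
    filter_upwards [ha] with x hx
    obtain ⟨v, hv, hvξ⟩ := hx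
    have h1 : ‖a ξ x‖ₑ ≤ ‖ξ‖ₑ * ‖v‖ₑ := by
      rw [hvξ, ← ofReal_norm, ← ofReal_norm, ← ofReal_norm,
        ← ENNReal.ofReal_mul (norm_nonneg _)]
      refine ENNReal.ofReal_le_ofReal ((norm_inner_le_norm _ _).trans_eq ?_)
      rw [J.norm_map, mul_comm]
    calc ‖a ξ x‖ₑ ^ 2 ≤ (‖ξ‖ₑ * ‖v‖ₑ) ^ 2 := by gcongr
      _ = ‖ξ‖ₑ ^ 2 * ‖v‖ₑ ^ 2 := mul_pow _ _ _
      _ ≤ _ := by gcongr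
  have hmem : ∀ ξ, MemLp (a ξ) 2 W := fun ξ => by
    refine ⟨(ham ξ).aestronglyMeasurable, ?_⟩
    have : eLpNorm (a ξ) 2 W ^ 2 < ∞ :=
      (hsq ξ).trans_lt (ENNReal.mul_lt_top (by simp) hk.lt_top)
    by_contra! hn
    rw [top_le_iff.1 hn] at this
    simp at this
  let A₀ : E →ₗ[ℝ] Lp ℝ 2 W :=
    { toFun := fun ξ => (hmem ξ).toLp (a ξ)
      map_add' := fun ξ η => by
        rw [← MemLp.toLp_add]
        refine MemLp.toLp_congr _ _ ?_
        filter_upwards [ha] with x hx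
        obtain ⟨v, -, hv⟩ := hx
        simp [hv, inner_add_right]
      map_smul' := fun r ξ => by
        rw [RingHom.id_apply, ← MemLp.toLp_const_smul]
        refine MemLp.toLp_congr _ _ ?_
        filter_upwards [ha] with x hx
        obtain ⟨v, -, hv⟩ := hx
        simp [hv, inner_smul_right] }
  have hA₀ : ∀ ξ, ‖A₀ ξ‖ₑ ^ 2 = eLpNorm (a ξ) 2 W ^ 2 := fun ξ => by
    rw [show ‖A₀ ξ‖ₑ = eLpNorm (a ξ) 2 W from Lp.enorm_toLp (hf := hmem ξ)]
  let A : E →L[ℝ] Lp ℝ 2 W := A₀.mkContinuous (Real.sqrt R.toReal) fun ξ => by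
    have h1 : ‖A₀ ξ‖ ^ 2 ≤ (Real.sqrt R.toReal * ‖ξ‖) ^ 2 := by
      have h2 := (hA₀ ξ).trans_le (hsq ξ)
      have h3 := ENNReal.toReal_mono (ENNReal.mul_ne_top (by simp) hk) h2
      rw [ENNReal.toReal_pow, toReal_enorm, ENNReal.toReal_mul, ENNReal.toReal_pow,
        toReal_enorm] at h3
      rw [mul_pow, Real.sq_sqrt ENNReal.toReal_nonneg, mul_comm]
      exact h3
    exact (pow_le_pow_iff_left₀ (norm_nonneg _) (by positivity) two_ne_zero).1 h1
  refine ⟨A, fun ξ => (hmem ξ).coeFn_toLp, ?_⟩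
  refine iSup_le fun w => iSup_le fun b => ?_
  -- Finite partial sums allow the exchange with the integral without countability of the basis.
  rw [ENNReal.tsum_eq_iSup_sum]
  refine iSup_le fun s => ?_
  have hAb : ∀ i, ‖A (b i)‖ₑ ^ 2 = ∫⁻ x, ‖a (b i) x‖ₑ ^ 2 ∂W := fun i =>
    (hA₀ (b i)).trans (eLpNorm_two_sq _)
  simp only [hAb]
  rw [← lintegral_finsetSum _ fun i _ => (ham (b i)).measurable.enorm.pow_const 2]
  refine lintegral_mono_ae ?_
  filter_upwards [ha] with x hx
  obtain ⟨v, hv, hvξ⟩ := hx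
  refine le_trans ?_ hv
  have hJ : Orthonormal ℝ fun i => J (b i) := b.orthonormal.comp_linearIsometry J
  have hb := hJ.sum_inner_products_le (x := v) (s := s)
  have e : ∀ i, ‖a (b i) x‖ₑ ^ 2 = ENNReal.ofReal (‖inner ℝ (J (b i)) v‖ ^ 2) := fun i => by
    rw [hvξ, ← ofReal_norm, ENNReal.ofReal_pow (norm_nonneg _), real_inner_comm]
  simp only [e]
  rw [← ENNReal.ofReal_sum_of_nonneg fun i _ => by positivity, ← ofReal_norm,
    ← ENNReal.ofReal_pow (norm_nonneg _)]
  exact ENNReal.ofReal_le_ofReal hb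

/-- Expectations under a law with density bounded by `M`, written as integrals over the plane. -/
theorem exists_density_mul {κ : Measure Plane} [IsProbabilityMeasure κ] {M : ℝ} (hM : 0 ≤ M)
    (hκ : κ ≤ ENNReal.ofReal M • volume) {ψ : Plane → ℝ} (hψ : Measurable ψ)
    (hψ2 : Integrable (fun y => ψ y ^ 2) κ) :
    ∃ h : Plane → ℝ, Integrable h ∧ MemLp h 2 ∧ (∫ x, ‖h x‖) ^ 2 ≤ ∫ y, ψ y ^ 2 ∂κ ∧
      ∫ x, ‖h x‖ ^ 2 ≤ M * ∫ y, ψ y ^ 2 ∂κ ∧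
      ∀ f : Plane → ℝ, Integrable (fun x => f x * h x) →
        Integrable (fun y => ψ y * f y) κ ∧ ∫ y, ψ y * f y ∂κ = ∫ x, f x * h x := by
  have hac : κ ≪ volume :=
    (Measure.absolutelyContinuous_of_le hκ).trans (Measure.smul_absolutelyContinuous)
  set g : Plane → ℝ≥0∞ := κ.rnDeriv volume with hg
  have hgm : Measurable g := Measure.measurable_rnDeriv _ _
  have hgκ : volume.withDensity g = κ := Measure.withDensity_rnDeriv_eq _ _ hac
  have hgM : g ≤ᵐ[volume] fun _ => ENNReal.ofReal M := by
    refine ae_le_of_forall_setLIntegral_le_of_sigmaFinite hgm fun s hs _ => ?_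
    rw [← withDensity_apply _ hs, hgκ, setLIntegral_const]
    exact hκ s
  have hgt : ∀ᵐ x ∂volume, g x < ∞ := by
    filter_upwards [hgM] with x hx
    exact hx.trans_lt ENNReal.ofReal_lt_top
  set G : Plane → ℝ := fun x => (g x).toReal with hG
  have hG0 : ∀ x, 0 ≤ G x := fun x => ENNReal.toReal_nonneg
  have hGm : Measurable G := hgm.ennreal_toReal
  have hGM : ∀ᵐ x ∂volume, G x ≤ M := by
    filter_upwards [hgM] with x hx
    exact ENNReal.toReal_le_of_le_ofReal hM hx
  have tr : ∀ u : Plane → ℝ, (Integrable u κ ↔ Integrable fun x => G x * u x) ∧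
      ∫ y, u y ∂κ = ∫ x, G x * u x := fun u => by
    constructor
    · conv_lhs => rw [← hgκ]
      exact integrable_withDensity_iff_integrable_smul' hgm hgt
    · conv_lhs => rw [← hgκ]
      exact integral_withDensity_eq_integral_toReal_smul hgm hgt u
  have hψL2 : MemLp ψ 2 κ := (memLp_two_iff_integrable_sq hψ.aestronglyMeasurable).2 hψ2
  have hψ1 : Integrable ψ κ := hψL2.integrable (by norm_num)
  have hD := (tr fun y => ψ y ^ 2).2
  have hDi := (tr fun y => ψ y ^ 2).1.1 hψ2
  -- One of the two factors `G` is bounded by `M`; the other is kept to recover `κ`.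
  have hpt : ∀ᵐ x ∂volume, (G x * ψ x) ^ 2 ≤ M * (G x * ψ x ^ 2) := by
    filter_upwards [hGM] with x hx
    nlinarith [mul_nonneg (mul_nonneg (hG0 x) (sq_nonneg (ψ x))) (sub_nonneg.2 hx)]
  have hsqi : Integrable fun x => (G x * ψ x) ^ 2 := by
    refine (hDi.const_mul M).mono' ((hGm.mul hψ).pow_const 2).aestronglyMeasurable ?_
    filter_upwards [hpt] with x hx
    rwa [Real.norm_of_nonneg (sq_nonneg _)]
  refine ⟨fun x => G x * ψ x, (tr ψ).1.1 hψ1,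
    (memLp_two_iff_integrable_sq (hGm.mul hψ).aestronglyMeasurable).2 hsqi, ?_, ?_, ?_⟩
  · have e : ∫ x, ‖G x * ψ x‖ = ∫ y, |ψ y| ∂κ := by
      rw [(tr _).2]
      simp [abs_of_nonneg (hG0 _)]
    rw [e]
    set A := ∫ y, |ψ y| ∂κ with hA
    -- Nonnegative variance of `|ψ|` under the probability measure `κ` gives `A² ≤ ∫ ψ² dκ`.
    have h1 : 0 ≤ ∫ y, (|ψ y| - A) ^ 2 ∂κ := integral_nonneg fun y => sq_nonneg _
    have h2 : ∫ y, (|ψ y| - A) ^ 2 ∂κ = (∫ y, ψ y ^ 2 ∂κ) - 2 * A * A + A ^ 2 := by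
      have : ∀ y, (|ψ y| - A) ^ 2 = ψ y ^ 2 - 2 * A * |ψ y| + A ^ 2 := fun y => by
        rw [sub_sq, sq_abs]; ring
      have hi : Integrable (fun y => ψ y ^ 2 - 2 * A * |ψ y|) κ := hψ2.sub (hψ1.abs.const_mul _)
      simp only [this]
      rw [integral_add hi (integrable_const _),
        integral_sub hψ2 (hψ1.abs.const_mul _), integral_const_mul]
      simp [← hA]
    nlinarith
  · rw [hD, ← integral_const_mul]
    simp only [Real.norm_eq_abs, sq_abs]
    exact integral_mono_ae hsqi (hDi.const_mul M) hpt
  · intro f hf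
    have e : (fun x => f x * (G x * ψ x)) = fun x => G x * (ψ x * f x) := by
      funext x; ring
    rw [e] at hf ⊢
    exact ⟨(tr _).1.2 hf, (tr _).2⟩

/-! ### Consequences of the admissibility of the weight -/

section Weight

variable {Ω : Type*} [MeasurableSpace Ω] {P : Measure Ω} {H : Plane → ℝ} {γ : LevelGraph H → ℝ}
  {X : ℝ → Plane → ℝ≥0 → Ω → Plane}

theorem IsAdmissibleWeight.continuous_liftToPlane (hγ : IsAdmissibleWeight P X γ) :
    Continuous (liftToPlane γ) :=
  hγ.continuous.comp continuous_quotient_mk'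

/-- Positivity of `γ` transfers statements valid almost everywhere for the weight, such as
identities in `H_γ`, to Lebesgue measure. -/
theorem IsAdmissibleWeight.volume_absolutelyContinuous (hγ : IsAdmissibleWeight P X γ) :
    (volume : Measure Plane) ≪ weightMeasure γ := by
  refine withDensity_absolutelyContinuous'
    hγ.continuous_liftToPlane.measurable.ennreal_ofReal.aemeasurable
    (Eventually.of_forall fun x => ?_)
  exact (ENNReal.ofReal_pos.2 (hγ.pos _)).ne'

end Weight

/-- The hypothesis on sets says `W.bind κ ≤ c • W`. With `u = |ψ|²` this is the bound of `S(t)` on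
the weighted space. -/
theorem lintegral_lintegral_le_of_bind_le {W : Measure Plane} {κ : Plane → Measure Plane}
    (hκ : Measurable κ) {c : ℝ≥0∞}
    (h : ∀ A, MeasurableSet A → ∫⁻ x, κ x A ∂W ≤ c * W A) {u : Plane → ℝ≥0∞} (hu : Measurable u) :
    ∫⁻ x, ∫⁻ y, u y ∂(κ x) ∂W ≤ c * ∫⁻ y, u y ∂W := by
  have hb : W.bind κ ≤ c • W := Measure.le_iff.2 fun s hs => by
    rw [Measure.bind_apply hs hκ.aemeasurable, Measure.smul_apply, smul_eq_mul]
    exact h s hs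
  rw [← Measure.lintegral_bind hκ.aemeasurable hu.aemeasurable, ← smul_eq_mul,
    ← lintegral_smul_measure]
  exact lintegral_mono' hb le_rfl

/-! ### The main estimate -/

theorem isFunction_of_forall {μ : Measure Plane} [μ.HasTemperateGrowth]
    {ξ : QDual μ} {f : Plane → ℝ} (hf : LocallyIntegrable f volume)
    (h : ∀ h : Plane → ℝ, Integrable h → MemLp h 2 → Integrable (fun x => f x * h x) ∧
      ∫ x, f x * h x = ∫ k, (conj (𝓕 (fun x => (h x : ℂ)) k) * spectralDensity μ ξ k).re ∂μ) :
    IsFunction ξ f := by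
  refine ⟨hf, fun φ => ?_⟩
  obtain ⟨h1, h2⟩ := h φ φ.integrable (φ.memLp 2)
  refine ⟨h1, ?_⟩
  rw [h2, apply_qClass_eq_integral]
  rfl

theorem exists_semigroupMul_of_measurable {Ω : Type*} [MeasurableSpace Ω] {P : Measure Ω}
    [IsProbabilityMeasure P] {B : ℝ≥0 → Ω → Plane} (hB : IsPlanarBrownianMotion B P)
    {H : Plane → ℝ} (hH : IsGenericHamiltonian H) {X : ℝ → Plane → ℝ≥0 → Ω → Plane}
    (hX : ∀ ε : ℝ, 0 < ε → ∀ x : Plane, IsFastDiffusion P B H ε x (X ε x))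
    {γ : LevelGraph H → ℝ} (hγ : IsAdmissibleWeight P X γ) {C : ℝ}
    (hC : ∀ ε : ℝ, 0 < ε → ∀ t : ℝ≥0, 0 < t → ∀ A : Set Plane, MeasurableSet A →
      ∫⁻ x, P.map (X ε x t) A ∂(weightMeasure γ)
        ≤ ENNReal.ofReal (Real.exp (C * t)) * weightMeasure γ A)
    {p : ℝ} (hp : 1 < p) {m : Plane → ℝ} (hm : Measurable m) (h0 : ∀ x, 0 ≤ m x)
    (hmp : MemLp m (ENNReal.ofReal p) volume)
    [(volume.withDensity fun x => ENNReal.ofReal (m x) : Measure Plane).HasTemperateGrowth]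
    {ε : ℝ} (hε : 0 < ε) (ψ : WeightedSpace γ) {t : ℝ≥0} (ht : 0 < t) :
    ∃ A : QDual (volume.withDensity fun x => ENNReal.ofReal (m x)) →L[ℝ] WeightedSpace γ,
      IsSemigroupMul P (X ε) t ψ A ∧
      hilbertSchmidtSq (E := QDual (volume.withDensity fun x => ENNReal.ofReal (m x)))
        (F := WeightedSpace γ) A ≤ ENNReal.ofReal
          (2 * (eLpNorm m (ENNReal.ofReal p) volume).toReal * (64 / (Real.pi * t)) ^ ((p - 1) / p)
            * Real.exp (C * t) * ‖ψ‖ ^ 2) := by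
  have hpi := Real.pi_pos
  have htr : (0 : ℝ) < t := by exact_mod_cast ht
  set μ : Measure Plane := volume.withDensity fun x => ENNReal.ofReal (m x) with hμ
  set M := 64 / (Real.pi * t) with hM
  have hM0 : 0 < M := by positivity
  set W := weightMeasure γ with hW
  set κ : Plane → Measure Plane := fun x => P.map (X ε x t) with hκ
  have hXm : ∀ x, AEMeasurable (X ε x t) P := fun x => (hX ε hε x).aemeasurable t
  have hκp : ∀ x, IsProbabilityMeasure (κ x) := fun x => Measure.isProbabilityMeasure_map (hXm x)
  have hκm : Measurable κ := measurable_map_fastDiffusion hB hH hε (hX ε hε) t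
  have hκM : ∀ x, κ x ≤ ENNReal.ofReal M • volume :=
    map_fastDiffusion_le hB hH hε (hX ε hε) ht
  have hψs : StronglyMeasurable ψ := Lp.stronglyMeasurable ψ
  have hψm : Measurable ψ := hψs.measurable
  choose f hfm hfl hf using fun ξ : QDual μ =>
    exists_function_of_spectralDensity hm h0 hp hmp (spectralDensity μ ξ)
  -- This is `S(t)ψ²`. It is finite only almost everywhere, and only at such points are the
  -- expectations shown to converge.
  set q : Plane → ℝ≥0∞ := fun x => ∫⁻ y, ‖ψ y‖ₑ ^ 2 ∂(κ x) with hq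
  have hqm : Measurable q := (Measure.measurable_lintegral (hψm.enorm.pow_const 2)).comp hκm
  have hqW : ∫⁻ x, q x ∂W ≤ ENNReal.ofReal (Real.exp (C * t)) * ‖ψ‖ₑ ^ 2 := by
    rw [Lp.enorm_def, eLpNorm_two_sq]
    exact lintegral_lintegral_le_of_bind_le hκm (hC ε hε t ht) (hψm.enorm.pow_const 2)
  have hqfin : ∀ᵐ x ∂W, q x < ∞ :=
    ae_lt_top hqm (hqW.trans_lt (ENNReal.mul_lt_top (by simp) (by simp))).ne
  set N := 2 * (eLpNorm m (ENNReal.ofReal p) volume).toReal * M ^ ((p - 1) / p) with hN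
  have hN0 : 0 ≤ N := by positivity
  -- The representative `v` is the class in `L²(μ)` of `𝓕h`, where `h` is the transition density
  -- from `x` times `ψ`.
  have hgood : ∀ x, q x < ∞ → ∃ v : Lp ℂ 2 μ, ‖v‖ₑ ^ 2 ≤ ENNReal.ofReal N * q x ∧
      ∀ ξ, Integrable (fun y => ψ y * f ξ y) (κ x) ∧
        ∫ y, ψ y * f ξ y ∂(κ x) = inner ℝ v (spectralDensity μ ξ) := by
    intro x hx
    have hψ2 : Integrable (fun y => ψ y ^ 2) (κ x) := by
      refine ⟨(hψm.pow_const 2).aestronglyMeasurable, ?_⟩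
      simpa [HasFiniteIntegral, enorm_pow] using hx
    have hD : ENNReal.ofReal (∫ y, ψ y ^ 2 ∂(κ x)) = q x := by
      rw [ofReal_integral_eq_lintegral_ofReal hψ2 (Eventually.of_forall fun y => sq_nonneg _)]
      refine lintegral_congr fun y => ?_
      rw [← ofReal_norm, ← ENNReal.ofReal_pow (norm_nonneg _), Real.norm_eq_abs, sq_abs]
    obtain ⟨h, h1, h2, hd1, hd2, hh⟩ := exists_density_mul hM0.le (hκM x) hψm hψ2
    have hc1 : Integrable fun x => (h x : ℂ) := h1.ofReal
    have hc2 : MemLp (fun x => (h x : ℂ)) 2 := h2.ofReal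
    have hF := (memLp_fourier_withDensity hm h0 hp hmp hc1 hc2 one_pos).1
    have hFle := integral_norm_fourier_sq_le hm h0 hp hmp hc1 hc2 hM0
      (D := ∫ y, ψ y ^ 2 ∂(κ x)) (by simpa using hd1) (by simpa using hd2)
    rw [integral_norm_sq_eq_norm_toLp hF] at hFle
    refine ⟨hF.toLp _, ?_, fun ξ => ?_⟩
    · rw [← ofReal_norm, ← ENNReal.ofReal_pow (norm_nonneg _), ← hD, ← ENNReal.ofReal_mul hN0]
      exact ENNReal.ofReal_le_ofReal hFle
    · obtain ⟨i1, i2⟩ := hf ξ h h1 h2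
      obtain ⟨j1, j2⟩ := hh (f ξ) i1
      refine ⟨j1, ?_⟩
      rw [j2, i2, L2.inner_def]
      refine integral_congr_ae ?_
      filter_upwards [hF.coeFn_toLp] with k hk
      rw [hk, Complex.inner, mul_comm]
  have ham : ∀ ξ, StronglyMeasurable fun x => ∫ y, ψ y * f ξ y ∂(κ x) := fun ξ => by
    have : StronglyMeasurable fun y => ψ y * f ξ y := (hψm.mul (hfm ξ)).stronglyMeasurable
    exact this.integral_kernel (κ := (⟨κ, hκm⟩ : Kernel Plane Plane))
  have hkfin : ∫⁻ x, ENNReal.ofReal N * q x ∂W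
      ≤ ENNReal.ofReal N * (ENNReal.ofReal (Real.exp (C * t)) * ‖ψ‖ₑ ^ 2) := by
    rw [lintegral_const_mul _ hqm]
    gcongr
  obtain ⟨A, hA, hHS⟩ := exists_operator_of_pointwise (W := W) (spectralDensity μ)
    (fun ξ x => ∫ y, ψ y * f ξ y ∂(κ x)) ham (fun x => ENNReal.ofReal N * q x)
    (by
      filter_upwards [hqfin] with x hx
      obtain ⟨v, hv, hvξ⟩ := hgood x hx
      exact ⟨v, hv, fun ξ => (hvξ ξ).2⟩)
    (hkfin.trans_lt (ENNReal.mul_lt_top (by simp) (ENNReal.mul_lt_top (by simp) (by simp)))).ne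
  refine ⟨A, fun ξ => ⟨f ξ, isFunction_of_forall (hfl ξ) (hf ξ), ?_⟩, ?_⟩
  · filter_upwards [hγ.volume_absolutelyContinuous.ae_le (hA ξ),
      hγ.volume_absolutelyContinuous.ae_le hqfin] with x hx hxq
    have hmeas : AEStronglyMeasurable (fun y => ψ y * f ξ y) (P.map (X ε x t)) :=
      (hψm.mul (hfm ξ)).aestronglyMeasurable
    obtain ⟨v, -, hv⟩ := hgood x hxq
    refine ⟨(integrable_map_measure hmeas (hXm x)).1 (hv ξ).1, ?_⟩
    rw [hx, markovSemigroup]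
    exact integral_map (hXm x) hmeas
  · refine hHS.trans (hkfin.trans_eq ?_)
    rw [← ofReal_norm, ← ENNReal.ofReal_pow (norm_nonneg _), ← ENNReal.ofReal_mul (by positivity),
      ← ENNReal.ofReal_mul hN0]
    congr 1
    ring

theorem mainTheorem7 {Ω : Type*} [MeasurableSpace Ω] (P : Measure Ω) [IsProbabilityMeasure P]
    (B : ℝ≥0 → Ω → Plane) (hB : IsPlanarBrownianMotion B P)
    (H : Plane → ℝ) (hH : IsGenericHamiltonian H)
    (X : ℝ → Plane → ℝ≥0 → Ω → Plane)
    (hX : ∀ ε : ℝ, 0 < ε → ∀ x : Plane, IsFastDiffusion P B H ε x (X ε x))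
    (γ : LevelGraph H → ℝ) (hγ : IsAdmissibleWeight P X γ)
    (p : ℝ) (hp : 1 < p) (T : ℝ) (hT : 0 < T) :
    ∃ C : ℝ, 0 < C ∧
      ∀ (m : Plane → ℝ), (∀ x, 0 ≤ m x) → MemLp m (ENNReal.ofReal p) volume →
      ∀ (μ : Measure Plane) [μ.HasTemperateGrowth] [μ.IsNegInvariant],
        μ = volume.withDensity (fun x => ENNReal.ofReal (m x)) →
      ∀ (ε : ℝ), 0 < ε → ∀ (ψ : WeightedSpace γ) (t : ℝ≥0), 0 < t → (t : ℝ) ≤ T →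
        ∃ A : QDual μ →L[ℝ] WeightedSpace γ,
          IsSemigroupMul P (X ε) t ψ A ∧ IsHilbertSchmidt (E := QDual μ) (F := WeightedSpace γ) A ∧
          hilbertSchmidtSq (E := QDual μ) (F := WeightedSpace γ) A ≤ ENNReal.ofReal
            (C * (eLpNorm m (ENNReal.ofReal p) volume).toReal
              * (t : ℝ) ^ (-((p - 1) / p)) * ‖ψ‖ ^ 2) := by
  obtain ⟨C₀, hC₀, hadm⟩ := hγ.admissible
  have hpi := Real.pi_pos
  -- The factor `2` comes from cutting `m`, `64/π` from the density bound, and `e^{C₀T}` from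
  -- admissibility, where `C₀ ≥ 0` and `t ≤ T`.
  refine ⟨2 * (64 / Real.pi) ^ ((p - 1) / p) * Real.exp (C₀ * T), by positivity, ?_⟩
  intro m h0 hmp μ _ _ hμ ε hε ψ t ht htT
  have htr : (0 : ℝ) < t := by exact_mod_cast ht
  -- The density `m` is only almost everywhere measurable; a measurable nonnegative version defines
  -- the same `μ`.
  set m' : Plane → ℝ := fun x => |hmp.1.mk m x| with hm'
  have hmm : Measurable m' := hmp.1.stronglyMeasurable_mk.measurable.abs
  have hae : m =ᵐ[volume] m' := by
    filter_upwards [hmp.1.ae_eq_mk] with x hx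
    change m x = |hmp.1.mk m x|
    rw [← hx, abs_of_nonneg (h0 x)]
  have hμ' : μ = volume.withDensity fun x => ENNReal.ofReal (m' x) := by
    rw [hμ]
    refine withDensity_congr_ae ?_
    filter_upwards [hae] with x hx
    rw [hx]
  clear hμ
  subst hμ'
  obtain ⟨A, hA, hHS⟩ := exists_semigroupMul_of_measurable hB hH hX hγ hadm hp hmm
    (fun x => abs_nonneg _) (hmp.ae_eq hae) hε ψ ht
  have hle := hHS.trans (ENNReal.ofReal_le_ofReal (q := 2 * (64 / Real.pi) ^ ((p - 1) / p)
    * Real.exp (C₀ * T) * (eLpNorm m (ENNReal.ofReal p) volume).toReal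
      * (t : ℝ) ^ (-((p - 1) / p)) * ‖ψ‖ ^ 2) (by
    rw [eLpNorm_congr_ae hae]
    have e : (64 / (Real.pi * t)) ^ ((p - 1) / p)
        = (64 / Real.pi) ^ ((p - 1) / p) * (t : ℝ) ^ (-((p - 1) / p)) := by
      rw [← div_div, Real.div_rpow (by positivity) htr.le, Real.rpow_neg htr.le, div_eq_mul_inv]
    rw [e]
    calc _ = 2 * (64 / Real.pi) ^ ((p - 1) / p) * Real.exp (C₀ * t)
          * (eLpNorm m' (ENNReal.ofReal p) volume).toReal * (t : ℝ) ^ (-((p - 1) / p))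
          * ‖ψ‖ ^ 2 := by ring
      _ ≤ _ := by gcongr))
  exact ⟨A, hA, hle.trans_lt ENNReal.ofReal_lt_top, hle⟩
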